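/- Let $d\ge 1$, $\beta>0$, $\lambda\ge 0$, $\overline\rho>0$. Let $l$ run through a sequence of numbers $l\ge 1$ with $l\to\infty$ and put $\Lambda_l=(-l/2,l/2)^d$, $V_l=l^d$. Let $h_l^0=-\tfrac12\Delta_D$ be the operator $-\tfrac12\Delta$ in $L^2(\Lambda_l)$ with Dirichlet boundary conditions, and $h_l=h_l^0+v_l$, where $v_l:\Lambda_l\to[0,\infty)$ is measurable and bounded. Let $\{\psi_k^l\}_{k\ge1}$ be an orthonormal basis of $L^2(\Lambda_l)$ of eigenfunctions of $h_l^0$, with eigenvalues $\varepsilon_1^l\le\varepsilon_2^l\le\cdots$, and let $\{\phi_i^l\}_{i\ge1}$ be an orthonormal basis of eigenfunctions of $h_l$, with eigenvalues $E_1^l\le E_2^l\le\cdots$ (eigenvalues counted with multiplicity). On the symmetric Fock space $\mathscr F_l$ over $L^2(\Lambda_l)$ let $a^*(f),a(f)$ be the boson creation and annihilation operators, $N_l(f)=a^*(f)a(f)$, $N_l=\sum_i N_l(\phi_i^l)$, and let $$H_l(\mu)=\sum_{i\ge1}(E_i^l-\mu)\,N_l(\phi_i^l)+\frac{\lambda}{2V_l}N_l^2$$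 be the Hamiltonian of the mean-field Bose gas (of the perfect gas if $\lambda=0$). Let $$\langle A\rangle_l=\frac{\mathrm{Tr}_{\mathscr F_l}\{e^{-\beta H_l(\mu_l)}A\}}{\mathrm{Tr}_{\mathscr F_l}\,e^{-\beta H_l(\mu_l)}}$$ be its Gibbs state, where the chemical potential $\mu_l\in\mathbb R$ is such that the trace in the denominator is finite and $V_l^{-1}\langle N_l\rangle_l=\overline\rho$. Suppose that every eigenfunction of $h_l$ is localized in the sense that, for each $i\ge1$, $$\lim_{l\to\infty}\frac1{l^{d/2}}\int_{\Lambda_l}|\phi_i^l(x)|\,dx=0 .$$ Then for each $k\ge1$ $$\lim_{l\to\infty}\frac1{V_l}\langle N_l(\psi_k^l)\rangle_l=0 .$$ In particular, any generalized Bose-Einstein condensation in the kinetic states is of type III: if $$\lim_{\delta\downarrow0}\lim_{l\to\infty}\frac1{V_l}\sum_{k:\,\varepsilon_k^l<\delta}\langle N_l(\psi_k^l)\rangle_l$$ exists and is positive, then no individual kinetic state is macroscopically occupied, that is, there is no $k$ for which $\lim_{l\to\infty}V_l^{-1}\langle N_l(\psi_k^l)\rangle_l$ exists and is positive. -/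

import Mathlib

open MeasureTheory Filter Topology
open scoped ENNReal ContDiff

noncomputable section

namespace BoseGas

/-! ### One-particle operators -/

/-- The open cube `Λ_l = (-l/2, l/2)^d`. -/
def box (d : ℕ) (l : ℝ) : Set (EuclideanSpace ℝ (Fin d)) :=
  {x | ∀ i, x i ∈ Set.Ioo (-l / 2) (l / 2)}

/-- The complex Hilbert space `L²(Ω)` for `Ω ⊆ ℝ^d`. -/
abbrev L2 {d : ℕ} (Ω : Set (EuclideanSpace ℝ (Fin d))) : Type :=
  Lp ℂ 2 (volume.restrict Ω)

/-- `ξ ∈ C_c^∞(Ω)`. -/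
def IsTestFunction {d : ℕ} (Ω : Set (EuclideanSpace ℝ (Fin d)))
    (ξ : EuclideanSpace ℝ (Fin d) → ℂ) : Prop :=
  ContDiff ℝ ∞ ξ ∧ HasCompactSupport ξ ∧ tsupport ξ ⊆ Ω

/-- The partial derivative `∂ξ/∂x_i`. -/
def partialDeriv {d : ℕ} (i : Fin d) (ξ : EuclideanSpace ℝ (Fin d) → ℂ)
    (x : EuclideanSpace ℝ (Fin d)) : ℂ :=
  fderiv ℝ ξ x (EuclideanSpace.single i 1)

/-- `u` belongs to the Sobolev space `H¹₀(Ω)`, the closure of `C_c^∞(Ω)` in the `H¹` norm,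
and `G` is its gradient. -/
def HasDirichletGradient {d : ℕ} (Ω : Set (EuclideanSpace ℝ (Fin d)))
    (u : L2 Ω) (G : Fin d → L2 Ω) : Prop :=
  ∃ ξ : ℕ → EuclideanSpace ℝ (Fin d) → ℂ,
    (∀ n, IsTestFunction Ω (ξ n)) ∧
    Tendsto (fun n => eLpNorm (fun x => ξ n x - u x) 2 (volume.restrict Ω)) atTop (𝓝 0) ∧
    ∀ i, Tendsto (fun n => eLpNorm (fun x => partialDeriv i (ξ n) x - G i x) 2
      (volume.restrict Ω)) atTop (𝓝 0)

/-- The graph of the self-adjoint operator `-½ Δ_D + v` in `L²(Ω)`, that is, of the operator of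
the quadratic form `½ ∫ |∇u|² + ∫ v |u|²` with form domain `H¹₀(Ω)` (for bounded `v`):
`u` is in its domain and it maps `u` to `w`. -/
def SchrodingerMapsTo {d : ℕ} (Ω : Set (EuclideanSpace ℝ (Fin d)))
    (v : EuclideanSpace ℝ (Fin d) → ℝ) (u w : L2 Ω) : Prop :=
  ∃ G : Fin d → L2 Ω, HasDirichletGradient Ω u G ∧
    ∀ ξ, IsTestFunction Ω ξ →
      (1 / 2 : ℂ) * ∑ i, ∫ x in Ω, G i x * partialDeriv i ξ x
        + ∫ x in Ω, (v x : ℂ) * u x * ξ x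
      = ∫ x in Ω, w x * ξ x

/-- A complete orthonormal system of eigenfunctions of `-½ Δ_D + v` in `L²(Ω)`, with the
corresponding eigenvalues in non-decreasing order (so counted with multiplicity). -/
structure EigenSystem {d : ℕ} (Ω : Set (EuclideanSpace ℝ (Fin d)))
    (v : EuclideanSpace ℝ (Fin d) → ℝ) where
  eigenfunction : HilbertBasis ℕ ℂ (L2 Ω)
  eigenvalue : ℕ → ℝ
  monotone_eigenvalue : Monotone eigenvalue
  isEigenfunction : ∀ i,
    SchrodingerMapsTo Ω v (eigenfunction i) ((eigenvalue i : ℂ) • eigenfunction i)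

/-! ### Unbounded operators on the symmetric Fock space -/

/-- Occupation numbers of the one-particle states of an orthonormal basis, finitely many
particles in total. -/
abbrev Occupation : Type := ℕ →₀ ℕ

/-- The symmetric Fock space over a separable Hilbert space with orthonormal basis `b`, in the
occupation number representation with respect to `b`: the coordinates of a vector are its
components along the orthonormal occupation number states. -/
abbrev FockSpace : Type := lp (fun _ : Occupation => ℂ) 2

/-- The occupation number state `|n⟩`. -/
def occState (n : Occupation) : FockSpace := lp.single 2 n 1

/-- The product `S T` of unbounded operators, on its natural domain. -/
def opMul {F : Type*} [AddCommGroup F] [Module ℂ F] (S T : F →ₗ.[ℂ] F) : F →ₗ.[ℂ] F where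
  domain :=
    { carrier := {Φ | ∃ h : Φ ∈ T.domain, T ⟨Φ, h⟩ ∈ S.domain}
      add_mem' := by
        rintro Φ Ψ ⟨h₁, h₂⟩ ⟨h₃, h₄⟩
        refine ⟨T.domain.add_mem h₁ h₃, ?_⟩
        have : T ⟨Φ + Ψ, T.domain.add_mem h₁ h₃⟩ = T ⟨Φ, h₁⟩ + T ⟨Ψ, h₃⟩ :=
          T.map_add ⟨Φ, h₁⟩ ⟨Ψ, h₃⟩
        rw [this]
        exact S.domain.add_mem h₂ h₄
      zero_mem' := by
        refine ⟨T.domain.zero_mem, ?_⟩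
        have : T ⟨0, T.domain.zero_mem⟩ = 0 := T.map_zero
        rw [this]
        exact S.domain.zero_mem
      smul_mem' := by
        rintro c Φ ⟨h₁, h₂⟩
        refine ⟨T.domain.smul_mem c h₁, ?_⟩
        have : T ⟨c • Φ, T.domain.smul_mem c h₁⟩ = c • T ⟨Φ, h₁⟩ := T.map_smul c ⟨Φ, h₁⟩
        rw [this]
        exact S.domain.smul_mem c h₂ }
  toFun :=
    { toFun := fun Φ => S ⟨T ⟨Φ.1, Φ.2.choose⟩, Φ.2.choose_spec⟩
      map_add' := by
        intro Φ Ψ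
        rw [← S.map_add]
        congr 1
        exact Subtype.ext (T.map_add ⟨Φ.1, Φ.2.choose⟩ ⟨Ψ.1, Ψ.2.choose⟩)
      map_smul' := by
        intro c Φ
        rw [RingHom.id_apply, ← S.map_smul]
        congr 1
        exact Subtype.ext (T.map_smul c ⟨Φ.1, Φ.2.choose⟩) }

/-- The operator of multiplication by the function `a` of the occupation numbers, on its maximal
domain. -/
def diagOp (a : Occupation → ℝ) : FockSpace →ₗ.[ℂ] FockSpace where
  domain :=
    { carrier := {Φ | Memℓp (fun n => (a n : ℂ) * Φ n) 2}
      add_mem' := by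
        intro Φ Ψ h₁ h₂
        have := Memℓp.add h₁ h₂
        refine (congrArg (fun f => Memℓp f 2) ?_).mp this
        funext n
        simp [mul_add]
      zero_mem' := by
        have : Memℓp (fun _ : Occupation => (0 : ℂ)) 2 := zero_memℓp
        simpa using this
      smul_mem' := by
        intro c Φ h
        have := Memℓp.const_smul h c
        refine (congrArg (fun f => Memℓp f 2) ?_).mp this
        funext n
        simp [mul_left_comm] }
  toFun :=
    { toFun := fun Φ => ⟨fun n => (a n : ℂ) * Φ.1 n, Φ.2⟩
      map_add' := by
        intro Φ Ψ
        refine lp.ext (funext fun n => ?_)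
        exact mul_add _ _ _
      map_smul' := by
        intro c Φ
        ext n
        simp [mul_left_comm] }

section Fields

variable {H : Type*} [NormedAddCommGroup H] [InnerProductSpace ℂ H]

/-- The creation operator `a*(f) = ∑ i, (b i, f) a*(b i)`, where
`a*(b i) |n⟩ = √(n i + 1) |n + δ_i⟩`, on its maximal domain. -/
def creation (b : HilbertBasis ℕ ℂ H) (f : H) : FockSpace →ₗ.[ℂ] FockSpace where
  domain :=
    { carrier := {Φ | Memℓp (fun n : Occupation => ∑ i ∈ n.support,
        inner ℂ (b i) f * (Real.sqrt (n i) : ℂ) * Φ (n - Finsupp.single i 1)) 2}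
      add_mem' := by
        intro Φ Ψ h₁ h₂
        have := Memℓp.add h₁ h₂
        refine (congrArg (fun f => Memℓp f 2) ?_).mp this
        funext n
        simp [mul_add, Finset.sum_add_distrib]
      zero_mem' := by
        have : Memℓp (fun _ : Occupation => (0 : ℂ)) 2 := zero_memℓp
        simpa using this
      smul_mem' := by
        intro c Φ h
        have := Memℓp.const_smul h c
        refine (congrArg (fun f => Memℓp f 2) ?_).mp this
        funext n
        simp [mul_left_comm, Finset.mul_sum] }
  toFun :=
    { toFun := fun Φ => ⟨fun n => ∑ i ∈ n.support,
        inner ℂ (b i) f * (Real.sqrt (n i) : ℂ) * Φ.1 (n - Finsupp.single i 1), Φ.2⟩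
      map_add' := by
        intro Φ Ψ
        refine lp.ext (funext fun n => ?_)
        exact (Finset.sum_congr rfl fun i _ => mul_add _ _ _).trans Finset.sum_add_distrib
      map_smul' := by
        intro c Φ
        ext n
        simp [mul_left_comm, Finset.mul_sum] }

/-- The annihilation operator `a(f) = ∑ i, (f, b i) a(b i)`, where
`a(b i) |n⟩ = √(n i) |n - δ_i⟩`, on its maximal domain. -/
def annihilation (b : HilbertBasis ℕ ℂ H) (f : H) : FockSpace →ₗ.[ℂ] FockSpace where
  domain :=
    { carrier := {Φ |
        (∀ n : Occupation, Summable fun i =>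
          inner ℂ f (b i) * (Real.sqrt (n i + 1) : ℂ) * Φ (n + Finsupp.single i 1)) ∧
        Memℓp (fun n : Occupation => ∑' i,
          inner ℂ f (b i) * (Real.sqrt (n i + 1) : ℂ) * Φ (n + Finsupp.single i 1)) 2}
      add_mem' := by
        rintro Φ Ψ ⟨h₁, h₂⟩ ⟨h₃, h₄⟩
        refine ⟨fun n => ?_, ?_⟩
        · simpa [mul_add] using (h₁ n).add (h₃ n)
        · have := Memℓp.add h₂ h₄
          refine (congrArg (fun f => Memℓp f 2) ?_).mp this
          funext n
          simp only [Pi.add_apply, ← (h₁ n).tsum_add (h₃ n), lp.coeFn_add, mul_add]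
      zero_mem' := by
        have : Memℓp (fun _ : Occupation => (0 : ℂ)) 2 := zero_memℓp
        refine ⟨fun n => ?_, ?_⟩
        · simp
        · simpa using this
      smul_mem' := by
        rintro c Φ ⟨h₁, h₂⟩
        refine ⟨fun n => ?_, ?_⟩
        · simpa [mul_left_comm] using (h₁ n).mul_left c
        · have := Memℓp.const_smul h₂ c
          refine (congrArg (fun f => Memℓp f 2) ?_).mp this
          funext n
          simp [mul_left_comm, tsum_mul_left] }
  toFun :=
    { toFun := fun Φ => ⟨fun n => ∑' i,
        inner ℂ f (b i) * (Real.sqrt (n i + 1) : ℂ) * Φ.1 (n + Finsupp.single i 1), Φ.2.2⟩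
      map_add' := by
        intro Φ Ψ
        ext n
        simp only [Submodule.coe_add, lp.coeFn_add, Pi.add_apply, mul_add]
        exact (Φ.2.1 n).tsum_add (Ψ.2.1 n)
      map_smul' := by
        intro c Φ
        ext n
        simp [mul_left_comm, tsum_mul_left] }

/-- The operator `N(f) = a*(f) a(f)` of the number of particles in the one-particle state `f`. -/
def numberOp (b : HilbertBasis ℕ ℂ H) (f : H) : FockSpace →ₗ.[ℂ] FockSpace :=
  opMul (creation b f) (annihilation b f)

end Fields

/-- The total number of particles `∑ i, n i` of the state `|n⟩`. -/
def particleNumber (n : Occupation) : ℕ := n.sum fun _ m => m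

/-- The total number operator `N = ∑ i, N(b i)`. -/
def totalNumberOp : FockSpace →ₗ.[ℂ] FockSpace := diagOp fun n => (particleNumber n : ℝ)

/-- The eigenvalue at `|n⟩` of the mean-field Hamiltonian
`H(μ) = dΓ(h) - μ N + (lam / (2 V)) N²`, `dΓ(h) = ∑ i, E i N(b i)`, for a one-particle operator
`h` with eigenvalues `E i` at the basis vectors `b i`. -/
def meanFieldEnergy (E : ℕ → ℝ) (μ lam V : ℝ) (n : Occupation) : ℝ :=
  (n.sum fun i m => E i * (m : ℝ)) - μ * (particleNumber n : ℝ)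
    + lam / (2 * V) * (particleNumber n : ℝ) ^ 2

/-- The mean-field Hamiltonian `H(μ)`, which is diagonal in the occupation number states. -/
def meanFieldHamiltonian (E : ℕ → ℝ) (μ lam V : ℝ) : FockSpace →ₗ.[ℂ] FockSpace :=
  diagOp (meanFieldEnergy E μ lam V)

/-- The operator `exp (-β H(μ))`: a function of an operator that is diagonal in the occupation
number states is the corresponding function of its eigenvalues. -/
def boltzmannOp (β : ℝ) (E : ℕ → ℝ) (μ lam V : ℝ) : FockSpace →ₗ.[ℂ] FockSpace :=
  diagOp fun n => Real.exp (-β * meanFieldEnergy E μ lam V n)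

open Classical in
/-- The trace, in `[0, ∞]`, of an operator with non-negative diagonal matrix elements. -/
def fockTrace (T : FockSpace →ₗ.[ℂ] FockSpace) : ℝ≥0∞ :=
  ∑' n : Occupation,
    if h : occState n ∈ T.domain then
      ENNReal.ofReal (inner ℂ (occState n) (T ⟨occState n, h⟩)).re
    else ∞

/-- The Gibbs expectation `⟨A⟩ = Tr (exp (-β H(μ)) A) / Tr (exp (-β H(μ)))` in `[0, ∞]` of a
non-negative observable `A`. Its value is `0` if the partition function is infinite. -/
def gibbs (β : ℝ) (E : ℕ → ℝ) (μ lam V : ℝ) (A : FockSpace →ₗ.[ℂ] FockSpace) : ℝ≥0∞ :=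
  fockTrace (opMul (boltzmannOp β E μ lam V) A) / fockTrace (boltzmannOp β E μ lam V)

/-! ### The Bose gas in the cube `Λ_l` -/

/-- The mean density `⟨N_l⟩ / V_l`, with `V_l = l^d`. -/
def totalDensity {d : ℕ} {l : ℝ} {v : EuclideanSpace ℝ (Fin d) → ℝ}
    (S : EigenSystem (box d l) v) (β μ lam : ℝ) : ℝ≥0∞ :=
  gibbs β S.eigenvalue μ lam (l ^ d) totalNumberOp / ENNReal.ofReal (l ^ d)

/-- The density `⟨N_l(f)⟩ / V_l` of particles in the one-particle state `f ∈ L²(Λ_l)`. -/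
def stateDensity {d : ℕ} {l : ℝ} {v : EuclideanSpace ℝ (Fin d) → ℝ}
    (S : EigenSystem (box d l) v) (β μ lam : ℝ) (f : L2 (box d l)) : ℝ≥0∞ :=
  gibbs β S.eigenvalue μ lam (l ^ d) (numberOp S.eigenfunction f) / ENNReal.ofReal (l ^ d)

/-- A sequence of one-particle states, with densities `r j`, is macroscopically occupied. -/
def MacroscopicallyOccupied (r : ℕ → ℝ≥0∞) : Prop :=
  ∃ c : ℝ≥0∞, 0 < c ∧ Tendsto r atTop (𝓝 c)

/-- Generalized condensation in states `k` with energies `ε j k` and densities `r j k`: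
`lim_{δ ↓ 0} lim_{j → ∞} ∑_{k : ε j k < δ} r j k` exists and is positive. -/
def GeneralizedBEC (ε : ℕ → ℕ → ℝ) (r : ℕ → ℕ → ℝ≥0∞) : Prop :=
  ∃ (g : ℝ → ℝ≥0∞) (c : ℝ≥0∞), 0 < c ∧
    (∀ᶠ δ in 𝓝[>] (0 : ℝ),
      Tendsto (fun j => ∑' k : {k : ℕ // ε j k < δ}, r j k) atTop (𝓝 (g δ))) ∧
    Tendsto g (𝓝[>] 0) (𝓝 c)

/-- Generalized condensation of type III: no individual state is macroscopically occupied. -/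
def TypeThreeBEC (ε : ℕ → ℕ → ℝ) (r : ℕ → ℕ → ℝ≥0∞) : Prop :=
  GeneralizedBEC ε r ∧ ∀ k, ¬ MacroscopicallyOccupied fun j => r j k

end BoseGas

end

/-!
Write `p i` for the density of particles in the `i`-th eigenstate of `h_l`. The Gibbs weight is
diagonal in the occupation number states built from the eigenstates `φ i`, so that the density in a
one-particle state `f` is `∑ i, |(φ i, f)|² p i`, and `∑ i, p i = ρ`. Exchanging the occupation
numbers of two eigenstates keeps the particle number, hence also the mean-field term, and
compares their energies; this shows that `p` is antitone (`antitone_occupationTrace`), so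
`p K ≤ ρ / (K + 1)`. Splitting the sum at `K` bounds the density in `f` by
`ρ ∑ i < K, |(φ i, f)|² + ρ / (K + 1)` for a unit vector `f` (`stateDensity_le`). It remains to show
that `(φ i, ψ k) → 0` for fixed `i` and `k`.

No explicit form of the kinetic eigenfunctions is needed, only that they vary slowly. Comparison
with `k + 1` rescaled bump functions of disjoint supports bounds the `k`-th kinetic eigenvalue by a
constant times `l⁻²` (`exists_two_mul_eigenvalue_le`), so `‖∇ ψ k‖₂ ≤ C / l`. A translation by a
vector of length at most `δ l` thus changes `ψ k` by at most a constant times `δ` in `L²`, whereas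
its average over all these translations is bounded pointwise by `vol (B_{δ l})^{-1/2}`, which is of
order `l^{-d/2}`. Hence `|(φ i, ψ k)|` is at most a constant, depending on `δ`, times
`l^{-d/2} ‖φ i‖₁`, plus a constant times `δ` (`HasDirichletGradient.enorm_inner_le`). Localization
sends the first term to zero, and `δ` is arbitrary (`tendsto_enorm_inner_eigenfunction`).
-/

noncomputable section

namespace BoseGas

/-! ### Diagonal operators and number operators on occupation number states -/

theorem occState_apply (n m : Occupation) : occState n m = if m = n then 1 else 0 := by
  change (lp.single 2 n (1 : ℂ) : FockSpace) m = _
  rw [lp.single_apply, Pi.single_apply]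

theorem fockTrace_eq_tsum {T : FockSpace →ₗ.[ℂ] FockSpace} (h : ∀ n, occState n ∈ T.domain) :
    fockTrace T = ∑' n, ENNReal.ofReal ((T ⟨occState n, h n⟩ : FockSpace) n).re := by
  unfold fockTrace
  refine tsum_congr fun n => ?_
  rw [dif_pos (h n)]
  congr 2
  exact (lp.inner_single_left n 1 _).trans (by simp)

theorem occState_mem_diagOp (a : Occupation → ℝ) (n : Occupation) :
    occState n ∈ (diagOp a).domain := by
  have h : (fun m => (a m : ℂ) * occState n m) = ⇑(lp.single 2 n (a n : ℂ) : FockSpace) := by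
    funext m
    rw [occState_apply, lp.single_apply, Pi.single_apply]
    split_ifs with h <;> simp [h]
  change Memℓp (fun m => (a m : ℂ) * occState n m) 2
  rw [h]
  exact lp.memℓp _

theorem diagOp_occState_apply (a : Occupation → ℝ) (n m : Occupation) :
    (diagOp a ⟨occState n, occState_mem_diagOp a n⟩ : FockSpace) m = a m * occState n m := rfl

theorem diagOp_occState (a : Occupation → ℝ) (n : Occupation) :
    diagOp a ⟨occState n, occState_mem_diagOp a n⟩ = (a n : ℂ) • occState n := by
  refine lp.ext (funext fun m => ?_)
  rw [diagOp_occState_apply, lp.coeFn_smul, Pi.smul_apply, smul_eq_mul, occState_apply]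
  split_ifs with h <;> simp [h]

theorem fockTrace_diagOp (a : Occupation → ℝ) :
    fockTrace (diagOp a) = ∑' n, ENNReal.ofReal (a n) := by
  rw [fockTrace_eq_tsum (occState_mem_diagOp a)]
  refine tsum_congr fun n => ?_
  simp [diagOp_occState_apply, occState_apply]

theorem fockTrace_opMul_diagOp (a c : Occupation → ℝ) :
    fockTrace (opMul (diagOp a) (diagOp c)) = ∑' n, ENNReal.ofReal (a n * c n) := by
  have h : ∀ n, occState n ∈ (opMul (diagOp a) (diagOp c)).domain := fun n => by
    refine ⟨occState_mem_diagOp c n, ?_⟩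
    rw [diagOp_occState]
    exact Submodule.smul_mem _ _ (occState_mem_diagOp a n)
  rw [fockTrace_eq_tsum h]
  refine tsum_congr fun n => ?_
  congr 1
  change ((a n : ℂ) * (c n * occState n n)).re = _
  rw [occState_apply, if_pos rfl, mul_one, ← Complex.ofReal_mul, Complex.ofReal_re]

theorem mem_diagOp_of_bounded {a : Occupation → ℝ} {M : ℝ} (ha : ∀ n, |a n| ≤ M)
    (Φ : FockSpace) : Φ ∈ (diagOp a).domain := by
  change Memℓp (fun m => (a m : ℂ) * Φ m) 2
  have hM : 0 ≤ M := (abs_nonneg _).trans (ha 0)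
  have hΦ : Memℓp (fun n => (M : ℂ) • Φ n) 2 := (lp.memℓp Φ).const_smul (M : ℂ)
  rw [memℓp_gen_iff (by norm_num)] at hΦ ⊢
  refine Summable.of_nonneg_of_le (fun n => by positivity) (fun n => ?_) hΦ
  refine Real.rpow_le_rpow (norm_nonneg _) ?_ (by norm_num)
  rw [norm_mul, norm_smul, Complex.norm_real, Complex.norm_real, Real.norm_eq_abs,
    Real.norm_of_nonneg hM]
  exact mul_le_mul_of_nonneg_right (ha n) (norm_nonneg _)

section

variable {H : Type*} [NormedAddCommGroup H] [InnerProductSpace ℂ H]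

theorem occState_mem_creation (b : HilbertBasis ℕ ℂ H) (f : H) (m : Occupation) :
    occState m ∈ (creation b f).domain := by
  change Memℓp (fun n : Occupation => ∑ i ∈ n.support,
        inner ℂ (b i) f * (Real.sqrt (n i) : ℂ) * occState m (n - Finsupp.single i 1)) 2
  have hinj : Function.Injective fun i : ℕ => m + Finsupp.single i 1 := fun i j hij =>
    Finsupp.single_left_injective one_ne_zero (add_left_cancel hij)
  have hsub : ∀ (n : Occupation) (i : ℕ), i ∈ n.support → n - Finsupp.single i 1 = m →
      n = m + Finsupp.single i 1 := fun n i hi h => by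
    rw [← h, tsub_add_cancel_of_le]
    exact Finsupp.single_le_iff.2 (Nat.one_le_iff_ne_zero.2 (Finsupp.mem_support_iff.1 hi))
  rw [memℓp_gen_iff (by norm_num), ← hinj.summable_iff]
  · have hb := (b.orthonormal.inner_products_summable f).mul_left ((particleNumber m : ℝ) + 1)
    refine Summable.of_nonneg_of_le (fun i => Real.rpow_nonneg (norm_nonneg _) _)
      (fun i => ?_) hb
    have hle : (m i : ℝ) ≤ particleNumber m := by
      rcases eq_or_ne (m i) 0 with h | h
      · simp [h]
      · exact_mod_cast Finset.single_le_sum (f := fun i => m i) (fun _ _ => Nat.zero_le _)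
          (Finsupp.mem_support_iff.2 h)
    have hsum : ∑ k ∈ (m + Finsupp.single i 1).support,
        inner ℂ (b k) f * (Real.sqrt ((m + Finsupp.single i 1 : Occupation) k) : ℂ) *
          occState m (m + Finsupp.single i 1 - Finsupp.single k 1)
        = inner ℂ (b i) f * (Real.sqrt (m i + 1) : ℂ) := by
      rw [Finset.sum_eq_single i]
      · simp [occState_apply]
      · intro k hk hki
        rw [occState_apply, if_neg, mul_zero]
        intro h
        exact hki (hinj (hsub _ _ hk h)).symm
      · intro h
        simp at h
    simp only [Function.comp_apply]
    rw [hsum, norm_mul, Complex.norm_real, Real.norm_of_nonneg (Real.sqrt_nonneg _)]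
    norm_num only [ENNReal.toReal_ofNat, Real.rpow_two]
    rw [mul_pow, Real.sq_sqrt (by positivity), mul_comm]
    gcongr
  · intro n hn
    rw [Finset.sum_eq_zero, norm_zero]
    · norm_num
    · intro i hi
      rw [occState_apply, if_neg, mul_zero]
      intro h
      exact hn ⟨i, (hsub n i hi h).symm⟩

/-- States with finitely many nonzero components are in the domain of every creation operator. -/
theorem mem_creation_of_finite (b : HilbertBasis ℕ ℂ H) (f : H) (Φ : FockSpace)
    (hΦ : {n | Φ n ≠ 0}.Finite) : Φ ∈ (creation b f).domain := by
  have h : Φ = ∑ m ∈ hΦ.toFinset, Φ m • occState m := by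
    refine lp.ext (funext fun n => ?_)
    rw [lp.coeFn_sum, Finset.sum_apply, Finset.sum_eq_single n]
    · rw [lp.coeFn_smul, Pi.smul_apply, occState_apply, if_pos rfl, smul_eq_mul, mul_one]
    · intro m _ hm
      rw [lp.coeFn_smul, Pi.smul_apply, occState_apply, if_neg hm.symm, smul_zero]
    · intro hn
      have : Φ n = 0 := by simpa using hn
      rw [this, zero_smul, lp.coeFn_zero, Pi.zero_apply]
  rw [h]
  exact Submodule.sum_mem _ fun m _ => Submodule.smul_mem _ _ (occState_mem_creation b f m)

theorem annihilation_term_eq_zero (b : HilbertBasis ℕ ℂ H) (f : H) {n m : Occupation} {i : ℕ}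
    (h : m + Finsupp.single i 1 ≠ n) :
    inner ℂ f (b i) * (Real.sqrt (m i + 1) : ℂ) * occState n (m + Finsupp.single i 1) = 0 := by
  rw [occState_apply, if_neg h, mul_zero]

theorem finite_annihilation_support (b : HilbertBasis ℕ ℂ H) (f : H) (n : Occupation) :
    {m : Occupation | ∑' i, inner ℂ f (b i) * (Real.sqrt (m i + 1) : ℂ) *
      occState n (m + Finsupp.single i 1) ≠ 0}.Finite := by
  refine (n.support.finite_toSet.image fun i => n - Finsupp.single i 1).subset fun m hm => ?_
  by_contra hcon
  refine hm ?_
  rw [← tsum_zero]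
  refine tsum_congr fun i => annihilation_term_eq_zero b f fun h => hcon ?_
  exact ⟨i, by simp [← h], by simp [← h]⟩

theorem occState_mem_annihilation (b : HilbertBasis ℕ ℂ H) (f : H) (n : Occupation) :
    occState n ∈ (annihilation b f).domain := by
  refine ⟨fun m => ?_, ?_⟩
  · refine summable_of_hasFiniteSupport ?_
    refine (n.support.finite_toSet).subset fun i hi => ?_
    by_contra hcon
    refine hi (annihilation_term_eq_zero b f fun h => hcon ?_)
    simp [← h]
  · exact (memℓp_zero (finite_annihilation_support b f n)).of_exponent_ge zero_le

theorem occState_mem_numberOp (b : HilbertBasis ℕ ℂ H) (f : H) (n : Occupation) :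
    occState n ∈ (numberOp b f).domain :=
  ⟨occState_mem_annihilation b f n,
    mem_creation_of_finite b f _ (finite_annihilation_support b f n)⟩

theorem opMul_apply {F : Type*} [AddCommGroup F] [Module ℂ F] (S T : F →ₗ.[ℂ] F) {Φ : F}
    (h : Φ ∈ T.domain) (h' : T ⟨Φ, h⟩ ∈ S.domain) :
    opMul S T ⟨Φ, h, h'⟩ = S ⟨T ⟨Φ, h⟩, h'⟩ := rfl

theorem creation_apply (b : HilbertBasis ℕ ℂ H) (f : H) (Φ : (creation b f).domain)
    (n : Occupation) : creation b f Φ n = ∑ i ∈ n.support,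
      inner ℂ (b i) f * (Real.sqrt (n i) : ℂ) * Φ.1 (n - Finsupp.single i 1) := rfl

theorem annihilation_apply (b : HilbertBasis ℕ ℂ H) (f : H) (Φ : (annihilation b f).domain)
    (n : Occupation) : annihilation b f Φ n = ∑' i,
      inner ℂ f (b i) * (Real.sqrt (n i + 1) : ℂ) * Φ.1 (n + Finsupp.single i 1) := rfl

/-- The expectation of `N(f)` in the state `|n⟩` is `∑ i, |(b i, f)|² n i`. -/
theorem numberOp_occState_apply_self (b : HilbertBasis ℕ ℂ H) (f : H) (n : Occupation) :
    (numberOp b f ⟨occState n, occState_mem_numberOp b f n⟩ : FockSpace) n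
      = ((∑ i ∈ n.support, ‖inner ℂ (b i) f‖ ^ 2 * n i : ℝ) : ℂ) := by
  unfold numberOp
  rw [opMul_apply _ _ (occState_mem_annihilation b f n)
    (mem_creation_of_finite b f _ (finite_annihilation_support b f n)), creation_apply,
    Complex.ofReal_sum]
  refine Finset.sum_congr rfl fun i hi => ?_
  have hpos : 1 ≤ n i := Nat.one_le_iff_ne_zero.2 (Finsupp.mem_support_iff.1 hi)
  have hcan : n - Finsupp.single i 1 + Finsupp.single i 1 = n :=
    tsub_add_cancel_of_le (Finsupp.single_le_iff.2 hpos)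
  rw [annihilation_apply, tsum_eq_single i, hcan, occState_apply, if_pos rfl]
  · have h1 : (((n - Finsupp.single i 1 : Occupation) i : ℕ) : ℝ) + 1 = n i := by
      rw [Finsupp.tsub_apply, Finsupp.single_eq_same]
      exact_mod_cast Nat.sub_add_cancel hpos
    rw [h1, ← inner_conj_symm f (b i), mul_one]
    have h2 : ((Real.sqrt (n i) : ℝ) : ℂ) * (Real.sqrt (n i) : ℝ) = (n i : ℝ) := by
      rw [← Complex.ofReal_mul, Real.mul_self_sqrt (Nat.cast_nonneg _)]
    rw [Complex.ofReal_mul, Complex.ofReal_pow, ← Complex.mul_conj', ← h2]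
    ring
  · intro j hj
    refine annihilation_term_eq_zero b f fun h => hj ?_
    exact Finsupp.single_left_injective one_ne_zero (add_left_cancel (h.trans hcan.symm))

theorem fockTrace_opMul_numberOp (b : HilbertBasis ℕ ℂ H) (f : H) {a : Occupation → ℝ} {M : ℝ}
    (ha : ∀ n, |a n| ≤ M) :
    fockTrace (opMul (diagOp a) (numberOp b f))
      = ∑' n, ENNReal.ofReal (a n * ∑ i ∈ n.support, ‖inner ℂ (b i) f‖ ^ 2 * n i) := by
  have h : ∀ n, occState n ∈ (opMul (diagOp a) (numberOp b f)).domain := fun n =>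
    ⟨occState_mem_numberOp b f n, mem_diagOp_of_bounded ha _⟩
  rw [fockTrace_eq_tsum h]
  refine tsum_congr fun n => ?_
  congr 1
  change ((a n : ℂ) * (numberOp b f ⟨occState n, occState_mem_numberOp b f n⟩ : FockSpace) n).re
    = _
  rw [numberOp_occState_apply_self, ← Complex.ofReal_mul, Complex.ofReal_re]

end

/-! ### Occupation of the one-particle eigenstates in the Gibbs state -/

/-- The Boltzmann weight `exp (-β H(μ))` of the state `|n⟩`. -/
def boltzmannWeight (β : ℝ) (E : ℕ → ℝ) (μ lam V : ℝ) (n : Occupation) : ℝ≥0∞ :=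
  ENNReal.ofReal (Real.exp (-β * meanFieldEnergy E μ lam V n))

/-- The unnormalized mean occupation number `Tr (exp (-β H(μ)) N(b i))` of the `i`-th one-particle
eigenstate. -/
def occupationTrace (β : ℝ) (E : ℕ → ℝ) (μ lam V : ℝ) (i : ℕ) : ℝ≥0∞ :=
  ∑' n : Occupation, boltzmannWeight β E μ lam V n * (n i : ℝ≥0∞)

section

variable {β : ℝ} {E : ℕ → ℝ} {μ lam V : ℝ}

theorem fockTrace_boltzmannOp :
    fockTrace (boltzmannOp β E μ lam V) = ∑' n, boltzmannWeight β E μ lam V n :=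
  fockTrace_diagOp _

/-- Each state contributes to a finite partition function, so `exp (-β H(μ))` is bounded. -/
theorem abs_exp_le_of_fockTrace_ne_top (h : fockTrace (boltzmannOp β E μ lam V) ≠ ⊤)
    (n : Occupation) : |Real.exp (-β * meanFieldEnergy E μ lam V n)|
      ≤ (fockTrace (boltzmannOp β E μ lam V)).toReal := by
  rw [abs_of_pos (Real.exp_pos _), ← ENNReal.ofReal_le_iff_le_toReal h, fockTrace_boltzmannOp]
  exact ENNReal.le_tsum n

theorem tsum_mul_apply_eq (c : ℕ → ℝ≥0∞) (n : Occupation) :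
    ∑' i, c i * (n i : ℝ≥0∞) = ∑ i ∈ n.support, c i * (n i : ℝ≥0∞) :=
  tsum_eq_sum fun i hi => by simp [Finsupp.notMem_support_iff.1 hi]

theorem fockTrace_boltzmannOp_totalNumberOp :
    fockTrace (opMul (boltzmannOp β E μ lam V) totalNumberOp)
      = ∑' i, occupationTrace β E μ lam V i := by
  unfold boltzmannOp totalNumberOp occupationTrace
  rw [fockTrace_opMul_diagOp, ENNReal.tsum_comm]
  refine tsum_congr fun n => ?_
  rw [ENNReal.tsum_mul_left, ENNReal.ofReal_mul (Real.exp_pos _).le]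
  congr 1
  have := tsum_mul_apply_eq (fun _ => 1) n
  simp only [one_mul] at this
  rw [this, ENNReal.ofReal_natCast, particleNumber, Finsupp.sum, Nat.cast_sum]

theorem fockTrace_boltzmannOp_numberOp {H : Type*} [NormedAddCommGroup H]
    [InnerProductSpace ℂ H] (b : HilbertBasis ℕ ℂ H) (f : H)
    (hZ : fockTrace (boltzmannOp β E μ lam V) ≠ ⊤) :
    fockTrace (opMul (boltzmannOp β E μ lam V) (numberOp b f))
      = ∑' i, ‖inner ℂ (b i) f‖ₑ ^ 2 * occupationTrace β E μ lam V i := by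
  have hb := fockTrace_opMul_numberOp b f (abs_exp_le_of_fockTrace_ne_top hZ)
  unfold occupationTrace
  simp_rw [← ENNReal.tsum_mul_left]
  rw [ENNReal.tsum_comm]
  refine hb.trans (tsum_congr fun n => ?_)
  simp_rw [mul_left_comm _ (boltzmannWeight β E μ lam V n)]
  rw [ENNReal.tsum_mul_left, ENNReal.ofReal_mul (Real.exp_pos _).le, tsum_mul_apply_eq,
    ENNReal.ofReal_sum_of_nonneg fun i _ => by positivity]
  refine congrArg (boltzmannWeight β E μ lam V n * ·) (Finset.sum_congr rfl fun i _ => ?_)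
  rw [ENNReal.ofReal_mul (by positivity), ENNReal.ofReal_natCast,
    ENNReal.ofReal_pow (norm_nonneg _), ofReal_norm]

/-- The occupation numbers with those of the states `i` and `j` exchanged. -/
def swapOccupation (i j : ℕ) : Occupation ≃ Occupation :=
  (Finsupp.domCongr (M := ℕ) (Equiv.swap i j)).toEquiv

theorem swapOccupation_apply (i j : ℕ) (n : Occupation) (k : ℕ) :
    swapOccupation i j n k = n (Equiv.swap i j k) := by
  simp [swapOccupation]

theorem particleNumber_swapOccupation (i j : ℕ) (n : Occupation) :
    particleNumber (swapOccupation i j n) = particleNumber n := by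
  simp only [swapOccupation, particleNumber, AddEquiv.toEquiv_eq_coe, AddEquiv.coe_toEquiv,
    Finsupp.domCongr_apply]
  rw [Finsupp.equivMapDomain_eq_mapDomain, Finsupp.sum_mapDomain_index] <;> simp

theorem energy_swapOccupation (E : ℕ → ℝ) {i j : ℕ} (hij : i ≠ j) (n : Occupation) :
    ((swapOccupation i j n).sum fun k m => E k * (m : ℝ))
      = (n.sum fun k m => E k * (m : ℝ)) + (E j - E i) * ((n i : ℝ) - n j) := by
  have h1 : ((swapOccupation i j n).sum fun k m => E k * (m : ℝ))
      = n.sum fun k m => E (Equiv.swap i j k) * (m : ℝ) := by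
    simp only [swapOccupation, AddEquiv.toEquiv_eq_coe, AddEquiv.coe_toEquiv,
      Finsupp.domCongr_apply]
    rw [Finsupp.equivMapDomain_eq_mapDomain, Finsupp.sum_mapDomain_index] <;> simp [mul_add]
  have h2 : ∀ e : ℕ → ℝ, (n.sum fun k m => e k * (m : ℝ))
      = ∑ k ∈ n.support ∪ {i, j}, e k * (n k : ℝ) := fun e =>
    Finsupp.sum_of_support_subset _ Finset.subset_union_left _ (by simp)
  rw [h1, h2, h2, ← sub_eq_iff_eq_add', ← Finset.sum_sub_distrib,
    ← Finset.sum_subset (Finset.subset_union_right : ({i, j} : Finset ℕ) ⊆ _), Finset.sum_pair hij,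
    Equiv.swap_apply_left, Equiv.swap_apply_right]
  · ring
  · intro k _ hk
    simp only [Finset.mem_insert, Finset.mem_singleton, not_or] at hk
    rw [Equiv.swap_apply_of_ne_of_ne hk.1 hk.2, sub_self]

theorem boltzmannWeight_swapOccupation_le (hβ : 0 ≤ β) {i j : ℕ} (hij : i ≠ j)
    (hE : E i ≤ E j) {n : Occupation} (hn : n j ≤ n i) :
    boltzmannWeight β E μ lam V (swapOccupation i j n) ≤ boltzmannWeight β E μ lam V n := by
  refine ENNReal.ofReal_le_ofReal (Real.exp_le_exp.2 ?_)
  rw [meanFieldEnergy, meanFieldEnergy, particleNumber_swapOccupation, energy_swapOccupation E hij]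
  have h : 0 ≤ (E j - E i) * ((n i : ℝ) - n j) :=
    mul_nonneg (sub_nonneg.2 hE) (sub_nonneg.2 (by exact_mod_cast hn))
  nlinarith [mul_nonneg hβ h]

/-- One-particle eigenstates of lower energy are occupied at least as much: exchanging the
occupation numbers of two states keeps the number of particles, and lowers the energy when it moves
particles to the state of lower energy. -/
theorem antitone_occupationTrace (hβ : 0 ≤ β) (hE : Monotone E) :
    Antitone (occupationTrace β E μ lam V) := by
  intro i j hle
  rcases eq_or_ne i j with rfl | hij
  · exact le_rfl
  -- both occupation numbers are their minimum plus a truncated difference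
  have split : ∀ i j : ℕ, occupationTrace β E μ lam V i
      = (∑' n : Occupation, boltzmannWeight β E μ lam V n * (min (n i) (n j) : ℕ))
        + ∑' n : Occupation, boltzmannWeight β E μ lam V n * (n i - n j : ℕ) := fun i j => by
    rw [← ENNReal.tsum_add]
    refine tsum_congr fun n => ?_
    rw [← mul_add, ← Nat.cast_add]
    congr 3
    omega
  rw [split i j, split j i]
  refine add_le_add (le_of_eq (tsum_congr fun n => by rw [min_comm])) ?_
  rw [← (swapOccupation i j).tsum_eq]
  refine ENNReal.tsum_le_tsum fun n => ?_
  rw [swapOccupation_apply, swapOccupation_apply, Equiv.swap_apply_left, Equiv.swap_apply_right]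
  rcases le_total (n j) (n i) with h | h
  · gcongr
    exact boltzmannWeight_swapOccupation_le hβ hij (hE hle) h
  · simp [Nat.sub_eq_zero_of_le h]

theorem add_one_mul_occupationTrace_le (hβ : 0 ≤ β) (hE : Monotone E) (K : ℕ) :
    (K + 1 : ℝ≥0∞) * occupationTrace β E μ lam V K ≤ ∑' i, occupationTrace β E μ lam V i := by
  calc (K + 1 : ℝ≥0∞) * occupationTrace β E μ lam V K
      = ∑ _i ∈ Finset.range (K + 1), occupationTrace β E μ lam V K := by
        simp [Finset.sum_const]
    _ ≤ ∑ i ∈ Finset.range (K + 1), occupationTrace β E μ lam V i :=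
        Finset.sum_le_sum fun i hi => antitone_occupationTrace hβ hE
          (Nat.lt_succ_iff.1 (Finset.mem_range.1 hi))
    _ ≤ _ := ENNReal.sum_le_tsum _

end

theorem tsum_enorm_inner_sq_le {H : Type*} [NormedAddCommGroup H] [InnerProductSpace ℂ H]
    (b : HilbertBasis ℕ ℂ H) (f : H) : ∑' i, ‖inner ℂ (b i) f‖ₑ ^ 2 ≤ ‖f‖ₑ ^ 2 := by
  have h := b.orthonormal.tsum_inner_products_le f
  have hs := b.orthonormal.inner_products_summable f
  have := ENNReal.ofReal_le_ofReal h
  rw [ENNReal.ofReal_tsum_of_nonneg (fun i => by positivity) hs] at this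
  simpa only [ENNReal.ofReal_pow (norm_nonneg _), ofReal_norm] using this

/-- The density of particles in the state `f` is small once `f` is nearly orthogonal to the first
`K` eigenstates: those hold at most all particles, and each of the others holds at most the fraction
`1 / (K + 1)` of them. -/
theorem stateDensity_le {d : ℕ} {l : ℝ} {v : EuclideanSpace ℝ (Fin d) → ℝ}
    (S : EigenSystem (box d l) v) {β μ lam : ℝ} (hβ : 0 ≤ β)
    (h0 : totalDensity S β μ lam ≠ 0) (f : L2 (box d l)) (K : ℕ) :
    stateDensity S β μ lam f ≤
      (∑ i ∈ Finset.range K, ‖inner ℂ (S.eigenfunction i) f‖ₑ ^ 2) * totalDensity S β μ lam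
        + ‖f‖ₑ ^ 2 * (totalDensity S β μ lam / (K + 1)) := by
  have hZ : fockTrace (boltzmannOp β S.eigenvalue μ lam (l ^ d)) ≠ ⊤ := fun h => h0 (by
    simp [totalDensity, gibbs, h])
  set p := occupationTrace β S.eigenvalue μ lam (l ^ d) with hp
  set Z := fockTrace (boltzmannOp β S.eigenvalue μ lam (l ^ d)) with hZdef
  have hT : totalDensity S β μ lam = (∑' i, p i) / Z / ENNReal.ofReal (l ^ d) := by
    rw [totalDensity, gibbs, fockTrace_boltzmannOp_totalNumberOp]
  have hpK : p K ≤ (∑' i, p i) / (K + 1) := by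
    rw [ENNReal.le_div_iff_mul_le (by simp) (by simp), mul_comm]
    exact add_one_mul_occupationTrace_le hβ S.monotone_eigenvalue K
  have key : ∑' i, ‖inner ℂ (S.eigenfunction i) f‖ₑ ^ 2 * p i ≤
      (∑ i ∈ Finset.range K, ‖inner ℂ (S.eigenfunction i) f‖ₑ ^ 2) * (∑' i, p i)
        + ‖f‖ₑ ^ 2 * ((∑' i, p i) / (K + 1)) := by
    rw [← ENNReal.summable.sum_add_tsum_nat_add' (k := K)]
    gcongr
    · rw [Finset.sum_mul]
      exact Finset.sum_le_sum fun i _ => by gcongr; exact ENNReal.le_tsum i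
    · calc ∑' i, ‖inner ℂ (S.eigenfunction (i + K)) f‖ₑ ^ 2 * p (i + K)
          ≤ ∑' i, ‖inner ℂ (S.eigenfunction (i + K)) f‖ₑ ^ 2 * ((∑' i, p i) / (K + 1)) := by
            refine ENNReal.tsum_le_tsum fun i => ?_
            gcongr
            exact (antitone_occupationTrace hβ S.monotone_eigenvalue
              (Nat.le_add_left K i)).trans hpK
        _ = (∑' i, ‖inner ℂ (S.eigenfunction (i + K)) f‖ₑ ^ 2) * ((∑' i, p i) / (K + 1)) :=
            ENNReal.tsum_mul_right
        _ ≤ _ := by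
            gcongr
            refine (ENNReal.tsum_comp_le_tsum_of_injective (add_left_injective K)
              fun i => ‖inner ℂ (S.eigenfunction i) f‖ₑ ^ 2).trans ?_
            exact tsum_enorm_inner_sq_le S.eigenfunction f
  rw [stateDensity, gibbs, fockTrace_boltzmannOp_numberOp _ _ hZ, hT]
  calc _ ≤ ((∑ i ∈ Finset.range K, ‖inner ℂ (S.eigenfunction i) f‖ₑ ^ 2) * (∑' i, p i)
        + ‖f‖ₑ ^ 2 * ((∑' i, p i) / (K + 1))) / Z / ENNReal.ofReal (l ^ d) := by
        gcongr
    _ = _ := by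
        simp only [div_eq_mul_inv]
        ring

/-! ### Functions of bounded energy do not concentrate -/

theorem lintegral_enorm_mul_le_eLpNorm_mul_eLpNorm {α F G : Type*} [MeasurableSpace α]
    [NormedAddCommGroup F] [NormedAddCommGroup G] {ν : Measure α} {f : α → F} {g : α → G}
    (hf : AEStronglyMeasurable f ν) (hg : AEStronglyMeasurable g ν) :
    ∫⁻ x, ‖f x‖ₑ * ‖g x‖ₑ ∂ν ≤ eLpNorm f 2 ν * eLpNorm g 2 ν := by
  have h := ENNReal.lintegral_mul_le_Lp_mul_Lq ν Real.HolderConjugate.two_two hf.enorm hg.enorm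
  rw [eLpNorm_eq_lintegral_rpow_enorm_toReal (by norm_num) (by norm_num),
    eLpNorm_eq_lintegral_rpow_enorm_toReal (by norm_num) (by norm_num)]
  simpa using h

section

variable {d : ℕ} {Ω : Set (EuclideanSpace ℝ (Fin d))}

theorem continuous_partialDeriv {ξ : EuclideanSpace ℝ (Fin d) → ℂ} (hξ : ContDiff ℝ 1 ξ)
    (i : Fin d) : Continuous (partialDeriv i ξ) :=
  (hξ.continuous_fderiv one_ne_zero).clm_apply continuous_const

theorem enorm_fderiv_apply_le (ξ : EuclideanSpace ℝ (Fin d) → ℂ)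
    (x y : EuclideanSpace ℝ (Fin d)) :
    ‖fderiv ℝ ξ x y‖ₑ ≤ ‖y‖ₑ * ∑ i, ‖partialDeriv i ξ x‖ₑ := by
  have hy : y = ∑ i, y i • EuclideanSpace.single i (1 : ℝ) := by
    simpa using ((EuclideanSpace.basisFun (Fin d) ℝ).sum_repr y).symm
  have h : fderiv ℝ ξ x y = ∑ i, y i • partialDeriv i ξ x := by
    conv_lhs => rw [hy]
    simp [partialDeriv]
  rw [h, Finset.mul_sum]
  refine (enorm_sum_le _ _).trans (Finset.sum_le_sum fun i _ => ?_)
  rw [enorm_smul]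
  gcongr
  rw [enorm_le_iff_norm_le]
  exact PiLp.norm_apply_le y i

theorem enorm_sub_translate_le {ξ : EuclideanSpace ℝ (Fin d) → ℂ} (hξ : ContDiff ℝ 1 ξ)
    (x y : EuclideanSpace ℝ (Fin d)) :
    ‖ξ x - ξ (x - y)‖ₑ ≤
      ∫⁻ t in Set.Ioc (0 : ℝ) 1, ‖y‖ₑ * ∑ i, ‖partialDeriv i ξ (x - (1 - t) • y)‖ₑ := by
  have hline : ∀ t : ℝ, HasDerivAt (fun t : ℝ => x - (1 - t) • y) y t := fun t => by
    simpa using (((hasDerivAt_id t).const_sub 1).smul_const y).const_sub x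
  have hderiv : ∀ t ∈ Set.uIcc (0 : ℝ) 1, HasDerivAt (fun t : ℝ => ξ (x - (1 - t) • y))
      (fderiv ℝ ξ (x - (1 - t) • y) y) t := fun t _ =>
    ((hξ.differentiable one_ne_zero _).hasFDerivAt).comp_hasDerivAt t (hline t)
  have hcont : Continuous fun t : ℝ => fderiv ℝ ξ (x - (1 - t) • y) y :=
    ((hξ.continuous_fderiv one_ne_zero).comp (by fun_prop)).clm_apply continuous_const
  have h := intervalIntegral.integral_eq_sub_of_hasDerivAt hderiv (hcont.intervalIntegrable _ _)
  simp only [sub_self, zero_smul, sub_zero, one_smul] at h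
  rw [← h, intervalIntegral.integral_of_le zero_le_one]
  exact (enorm_integral_le_lintegral_enorm _).trans
    (lintegral_mono fun t => enorm_fderiv_apply_le _ _ _)

theorem eLpNorm_comp_sub_restrict_le {F : Type*} [NormedAddCommGroup F]
    {g : EuclideanSpace ℝ (Fin d) → F} (hg : AEStronglyMeasurable g volume)
    (z : EuclideanSpace ℝ (Fin d)) :
    eLpNorm (fun x => g (x - z)) 2 (volume.restrict Ω) ≤ eLpNorm g 2 volume :=
  (eLpNorm_mono_measure _ Measure.restrict_le_self).trans
    (eLpNorm_comp_measurePreserving hg (measurePreserving_sub_right volume z)).le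

theorem lintegral_enorm_mul_sub_translate_le {f ξ : EuclideanSpace ℝ (Fin d) → ℂ}
    (hf : StronglyMeasurable f) (hξ : ContDiff ℝ 1 ξ) (y : EuclideanSpace ℝ (Fin d)) :
    ∫⁻ x in Ω, ‖f x‖ₑ * ‖ξ x - ξ (x - y)‖ₑ ≤
      ‖y‖ₑ * (eLpNorm f 2 (volume.restrict Ω) * ∑ i, eLpNorm (partialDeriv i ξ) 2 volume) := by
  have hc := fun i => continuous_partialDeriv hξ i
  calc ∫⁻ x in Ω, ‖f x‖ₑ * ‖ξ x - ξ (x - y)‖ₑ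
      ≤ ∫⁻ x in Ω, ∫⁻ t in Set.Ioc (0 : ℝ) 1,
          ‖f x‖ₑ * (‖y‖ₑ * ∑ i, ‖partialDeriv i ξ (x - (1 - t) • y)‖ₑ) := by
        refine lintegral_mono fun x => ?_
        rw [lintegral_const_mul' _ _ enorm_ne_top]
        gcongr
        exact enorm_sub_translate_le hξ x y
    _ = ∫⁻ t in Set.Ioc (0 : ℝ) 1, ∫⁻ x in Ω,
          ‖f x‖ₑ * (‖y‖ₑ * ∑ i, ‖partialDeriv i ξ (x - (1 - t) • y)‖ₑ) := by
        refine lintegral_lintegral_swap (Measurable.aemeasurable ?_)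
        refine (hf.measurable.enorm.comp measurable_fst).mul (Continuous.measurable ?_)
        refine ENNReal.continuous_const_mul enorm_ne_top |>.comp ?_
        exact continuous_finsetSum _ fun i _ => ((hc i).comp (by fun_prop)).enorm
    _ ≤ ∫⁻ t in Set.Ioc (0 : ℝ) 1, ‖y‖ₑ *
          (eLpNorm f 2 (volume.restrict Ω) * ∑ i, eLpNorm (partialDeriv i ξ) 2 volume) := by
        refine lintegral_mono fun t => ?_
        simp_rw [mul_left_comm _ ‖y‖ₑ]
        rw [lintegral_const_mul' _ _ enorm_ne_top]
        gcongr
        simp_rw [Finset.mul_sum]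
        rw [lintegral_finsetSum' _ fun i _ => ?_]
        · refine Finset.sum_le_sum fun i _ => ?_
          refine (lintegral_enorm_mul_le_eLpNorm_mul_eLpNorm hf.aestronglyMeasurable
            ((hc i).comp (continuous_sub_right ((1 - t) • y))).aestronglyMeasurable).trans ?_
          gcongr
          exact eLpNorm_comp_sub_restrict_le (hc i).aestronglyMeasurable _
        · exact (hf.measurable.enorm.mul
            ((hc i).comp (continuous_sub_right ((1 - t) • y))).measurable.enorm).aemeasurable
    _ = _ := by simp

/-- Averaging over translations by the vectors of a ball bounds the pairing of `f` with a smooth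
function of bounded energy by the `L¹` norm of `f`, up to an error proportional to the radius. -/
theorem lintegral_enorm_mul_le_of_contDiff {f ξ : EuclideanSpace ℝ (Fin d) → ℂ}
    (hf : StronglyMeasurable f) (hξ : ContDiff ℝ 1 ξ) {r : ℝ} (hr : 0 < r) :
    ∫⁻ x in Ω, ‖f x‖ₑ * ‖ξ x‖ₑ ≤
      volume (Metric.ball (0 : EuclideanSpace ℝ (Fin d)) r) ^ (-(1 / 2) : ℝ)
          * ((∫⁻ x in Ω, ‖f x‖ₑ) * eLpNorm ξ 2 volume)
        + ENNReal.ofReal r *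
          (eLpNorm f 2 (volume.restrict Ω) * ∑ i, eLpNorm (partialDeriv i ξ) 2 volume) := by
  set B := Metric.ball (0 : EuclideanSpace ℝ (Fin d)) r with hB
  have hB0 : volume B ≠ 0 := (Metric.measure_ball_pos _ _ hr).ne'
  have hBt : volume B ≠ ⊤ := measure_ball_lt_top.ne
  have hc := hξ.continuous
  set D := eLpNorm f 2 (volume.restrict Ω) * ∑ i, eLpNorm (partialDeriv i ξ) 2 volume with hD
  -- the average of `|ξ|` over a ball is bounded by the Cauchy-Schwarz inequality
  have havg : ∀ x, ∫⁻ y in B, ‖ξ (x - y)‖ₑ ≤ volume B ^ (1 / 2 : ℝ) * eLpNorm ξ 2 volume := by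
    intro x
    have h := lintegral_enorm_mul_le_eLpNorm_mul_eLpNorm (ν := volume.restrict B)
      (f := fun _ => (1 : ℂ)) (g := fun y => ξ (x - y)) aestronglyMeasurable_const
      (hc.comp (continuous_sub_left x)).aestronglyMeasurable
    simp only [enorm_one, one_mul] at h
    refine h.trans ?_
    gcongr
    · rw [eLpNorm_const _ (by norm_num) (by simpa using hB0)]
      simp
    · exact (eLpNorm_mono_measure _ Measure.restrict_le_self).trans
        (eLpNorm_comp_measurePreserving hc.aestronglyMeasurable
          (Measure.measurePreserving_sub_left volume x)).le
  have hmeas : Measurable fun p : EuclideanSpace ℝ (Fin d) × EuclideanSpace ℝ (Fin d) =>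
      ‖f p.2‖ₑ * ‖ξ (p.2 - p.1)‖ₑ :=
    (hf.measurable.enorm.comp measurable_snd).mul
      (hc.comp (continuous_snd.sub continuous_fst)).enorm.measurable
  have key : volume B * ∫⁻ x in Ω, ‖f x‖ₑ * ‖ξ x‖ₑ ≤
      volume B ^ (1 / 2 : ℝ) * ((∫⁻ x in Ω, ‖f x‖ₑ) * eLpNorm ξ 2 volume)
        + volume B * (ENNReal.ofReal r * D) := by
    calc volume B * ∫⁻ x in Ω, ‖f x‖ₑ * ‖ξ x‖ₑ
        = ∫⁻ _y in B, ∫⁻ x in Ω, ‖f x‖ₑ * ‖ξ x‖ₑ := by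
          rw [setLIntegral_const, mul_comm]
      _ ≤ ∫⁻ y in B, ((∫⁻ x in Ω, ‖f x‖ₑ * ‖ξ (x - y)‖ₑ) + ENNReal.ofReal r * D) := by
          refine setLIntegral_mono' measurableSet_ball fun y hy => ?_
          have hy' : ‖y‖ₑ ≤ ENNReal.ofReal r := by
            rw [← ofReal_norm]
            exact ENNReal.ofReal_le_ofReal (by simpa using (mem_ball_zero_iff.1 hy).le)
          calc ∫⁻ x in Ω, ‖f x‖ₑ * ‖ξ x‖ₑ
              ≤ ∫⁻ x in Ω, (‖f x‖ₑ * ‖ξ (x - y)‖ₑ + ‖f x‖ₑ * ‖ξ x - ξ (x - y)‖ₑ) := by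
                refine lintegral_mono fun x => ?_
                rw [← mul_add]
                gcongr
                simpa using enorm_add_le (ξ (x - y)) (ξ x - ξ (x - y))
            _ = (∫⁻ x in Ω, ‖f x‖ₑ * ‖ξ (x - y)‖ₑ)
                  + ∫⁻ x in Ω, ‖f x‖ₑ * ‖ξ x - ξ (x - y)‖ₑ :=
                lintegral_add_left (hmeas.comp measurable_prodMk_left) _
            _ ≤ _ := by
                gcongr
                exact (lintegral_enorm_mul_sub_translate_le hf hξ y).trans (by gcongr)
      _ = (∫⁻ y in B, ∫⁻ x in Ω, ‖f x‖ₑ * ‖ξ (x - y)‖ₑ) + volume B * (ENNReal.ofReal r * D) := by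
          rw [lintegral_add_right _ measurable_const, setLIntegral_const, mul_comm (volume B)]
      _ = (∫⁻ x in Ω, ∫⁻ y in B, ‖f x‖ₑ * ‖ξ (x - y)‖ₑ) + volume B * (ENNReal.ofReal r * D) := by
          rw [lintegral_lintegral_swap hmeas.aemeasurable]
      _ ≤ _ := by
          gcongr
          calc ∫⁻ x in Ω, ∫⁻ y in B, ‖f x‖ₑ * ‖ξ (x - y)‖ₑ
              ≤ ∫⁻ x in Ω, ‖f x‖ₑ * (volume B ^ (1 / 2 : ℝ) * eLpNorm ξ 2 volume) := by
                refine lintegral_mono fun x => ?_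
                rw [lintegral_const_mul' _ _ enorm_ne_top]
                gcongr
                exact havg x
            _ = _ := by
                rw [lintegral_mul_const _ hf.measurable.enorm]
                ring
  have hinv : volume B ^ (-(1 / 2) : ℝ) = (volume B)⁻¹ * volume B ^ (1 / 2 : ℝ) := by
    rw [← ENNReal.rpow_neg_one, ← ENNReal.rpow_add _ _ hB0 hBt]
    norm_num
  calc ∫⁻ x in Ω, ‖f x‖ₑ * ‖ξ x‖ₑ
      = (volume B)⁻¹ * (volume B * ∫⁻ x in Ω, ‖f x‖ₑ * ‖ξ x‖ₑ) := by
        rw [← mul_assoc, ENNReal.inv_mul_cancel hB0 hBt, one_mul]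
    _ ≤ (volume B)⁻¹ * (volume B ^ (1 / 2 : ℝ) * ((∫⁻ x in Ω, ‖f x‖ₑ) * eLpNorm ξ 2 volume)
        + volume B * (ENNReal.ofReal r * D)) := by gcongr
    _ = _ := by
        rw [mul_add, ← mul_assoc, ← hinv, ← mul_assoc (volume B)⁻¹ (volume B),
          ENNReal.inv_mul_cancel hB0 hBt, one_mul]

end

/-! ### Test functions and Dirichlet gradients -/

section

variable {d : ℕ} {Ω : Set (EuclideanSpace ℝ (Fin d))} {ξ : EuclideanSpace ℝ (Fin d) → ℂ}

namespace IsTestFunction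

theorem contDiff_one (h : IsTestFunction Ω ξ) : ContDiff ℝ 1 ξ :=
  h.1.of_le (by exact_mod_cast le_top)

theorem memLp (h : IsTestFunction Ω ξ) : MemLp ξ 2 (volume.restrict Ω) :=
  (h.1.continuous.memLp_of_hasCompactSupport h.2.1).restrict Ω

theorem memLp_partialDeriv (h : IsTestFunction Ω ξ) (i : Fin d) :
    MemLp (partialDeriv i ξ) 2 (volume.restrict Ω) :=
  ((continuous_partialDeriv h.contDiff_one i).memLp_of_hasCompactSupport
    (h.2.1.fderiv_apply (𝕜 := ℝ) (EuclideanSpace.single i 1))).restrict Ω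

/-- A test function as an element of `L²(Ω)`. -/
def toL2 (h : IsTestFunction Ω ξ) : L2 Ω := h.memLp.toLp

/-- The gradient of a test function, with components in `L²(Ω)`. -/
def grad (h : IsTestFunction Ω ξ) (i : Fin d) : L2 Ω := (h.memLp_partialDeriv i).toLp

theorem eLpNorm_restrict (h : IsTestFunction Ω ξ) :
    eLpNorm ξ 2 (volume.restrict Ω) = eLpNorm ξ 2 volume :=
  eLpNorm_restrict_eq_of_support_subset ((subset_tsupport ξ).trans h.2.2)

theorem eLpNorm_partialDeriv_restrict (h : IsTestFunction Ω ξ) (i : Fin d) :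
    eLpNorm (partialDeriv i ξ) 2 (volume.restrict Ω) = eLpNorm (partialDeriv i ξ) 2 volume :=
  eLpNorm_restrict_eq_of_support_subset (((subset_tsupport _).trans
    (tsupport_fderiv_apply_subset ℝ (EuclideanSpace.single i 1))).trans h.2.2)

theorem enorm_toL2 (h : IsTestFunction Ω ξ) : ‖h.toL2‖ₑ = eLpNorm ξ 2 volume := by
  rw [toL2, Lp.enorm_toLp, h.eLpNorm_restrict]

theorem enorm_grad (h : IsTestFunction Ω ξ) (i : Fin d) :
    ‖h.grad i‖ₑ = eLpNorm (partialDeriv i ξ) 2 volume := by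
  rw [grad, Lp.enorm_toLp, h.eLpNorm_partialDeriv_restrict]

theorem partialDeriv_conj (h : IsTestFunction Ω ξ) (i : Fin d) (x : EuclideanSpace ℝ (Fin d)) :
    partialDeriv i (fun x => starRingEnd ℂ (ξ x)) x = starRingEnd ℂ (partialDeriv i ξ x) := by
  have h1 : HasFDerivAt ξ (fderiv ℝ ξ x) x :=
    (h.contDiff_one.differentiable one_ne_zero x).hasFDerivAt
  have h2 := (Complex.conjCLE.toContinuousLinearMap.hasFDerivAt (x := ξ x)).comp x h1
  have h3 : fderiv ℝ (fun x => starRingEnd ℂ (ξ x)) x = _ := h2.fderiv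
  rw [partialDeriv, h3]
  rfl

theorem conj (h : IsTestFunction Ω ξ) : IsTestFunction Ω fun x => starRingEnd ℂ (ξ x) := by
  have hs : Function.support (fun x => starRingEnd ℂ (ξ x)) = Function.support ξ := by
    ext x
    simp
  have ht : tsupport (fun x => starRingEnd ℂ (ξ x)) = tsupport ξ := by
    rw [tsupport, hs, tsupport]
  refine ⟨Complex.conjCLE.contDiff.comp h.1, ?_, ?_⟩
  · rw [HasCompactSupport, ht]
    exact h.2.1
  · rw [ht]
    exact h.2.2

end IsTestFunction

theorem HasDirichletGradient.exists_tendsto {u : L2 Ω} {G : Fin d → L2 Ω}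
    (h : HasDirichletGradient Ω u G) :
    ∃ (ξ : ℕ → EuclideanSpace ℝ (Fin d) → ℂ) (hξ : ∀ n, IsTestFunction Ω (ξ n)),
      Tendsto (fun n => (hξ n).toL2) atTop (𝓝 u) ∧
      ∀ i, Tendsto (fun n => (hξ n).grad i) atTop (𝓝 (G i)) := by
  obtain ⟨ξ, hξ, hu, hG⟩ := h
  refine ⟨ξ, hξ, ?_, fun i => ?_⟩
  · rw [Lp.tendsto_Lp_iff_tendsto_eLpNorm']
    refine hu.congr fun n => eLpNorm_congr_ae ?_
    filter_upwards [(hξ n).memLp.coeFn_toLp] with x hx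
    rw [Pi.sub_apply, IsTestFunction.toL2, hx]
  · rw [Lp.tendsto_Lp_iff_tendsto_eLpNorm']
    refine (hG i).congr fun n => eLpNorm_congr_ae ?_
    filter_upwards [((hξ n).memLp_partialDeriv i).coeFn_toLp] with x hx
    rw [Pi.sub_apply, IsTestFunction.grad, hx]

/-- A function in `H¹₀(Ω)` pairs weakly with functions of small `L¹` norm: the bound for smooth
functions passes to limits of test functions. -/
theorem HasDirichletGradient.enorm_inner_le {u : L2 Ω} {G : Fin d → L2 Ω}
    (h : HasDirichletGradient Ω u G) (f : L2 Ω) (hf : ∫⁻ x in Ω, ‖f x‖ₑ ≠ ⊤)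
    {r : ℝ} (hr : 0 < r) :
    ‖inner ℂ f u‖ₑ ≤
      volume (Metric.ball (0 : EuclideanSpace ℝ (Fin d)) r) ^ (-(1 / 2) : ℝ)
          * ((∫⁻ x in Ω, ‖f x‖ₑ) * ‖u‖ₑ)
        + ENNReal.ofReal r * (‖f‖ₑ * ∑ i, ‖G i‖ₑ) := by
  obtain ⟨ξ, hξ, hu, hG⟩ := h.exists_tendsto
  have hlim : Tendsto (fun n =>
      volume (Metric.ball (0 : EuclideanSpace ℝ (Fin d)) r) ^ (-(1 / 2) : ℝ)
          * ((∫⁻ x in Ω, ‖f x‖ₑ) * ‖(hξ n).toL2‖ₑ)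
        + ENNReal.ofReal r * (‖f‖ₑ * ∑ i, ‖(hξ n).grad i‖ₑ)) atTop
      (𝓝 (volume (Metric.ball (0 : EuclideanSpace ℝ (Fin d)) r) ^ (-(1 / 2) : ℝ)
          * ((∫⁻ x in Ω, ‖f x‖ₑ) * ‖u‖ₑ)
        + ENNReal.ofReal r * (‖f‖ₑ * ∑ i, ‖G i‖ₑ))) := by
    refine Tendsto.add ?_ ?_
    · refine ENNReal.Tendsto.const_mul (ENNReal.Tendsto.const_mul hu.enorm (Or.inr hf)) (Or.inr ?_)
      exact ENNReal.rpow_ne_top_of_ne_zero (Metric.measure_ball_pos _ _ hr).ne'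
        measure_ball_lt_top.ne
    · refine ENNReal.Tendsto.const_mul (ENNReal.Tendsto.const_mul
        (tendsto_finsetSum _ fun i _ => (hG i).enorm) (Or.inr enorm_ne_top))
        (Or.inr ENNReal.ofReal_ne_top)
  refine le_of_tendsto_of_tendsto' (Filter.Tendsto.inner tendsto_const_nhds hu).enorm hlim
    fun n => ?_
  have hb := lintegral_enorm_mul_le_of_contDiff (Ω := Ω) (Lp.stronglyMeasurable f)
    (hξ n).contDiff_one hr
  simp only [← (hξ n).enorm_toL2, ← (hξ n).enorm_grad, ← Lp.enorm_def] at hb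
  refine le_trans ?_ hb
  rw [L2.inner_def]
  refine (enorm_integral_le_lintegral_enorm _).trans (lintegral_mono_ae ?_)
  filter_upwards [(hξ n).memLp.coeFn_toLp] with x hx
  rw [IsTestFunction.toL2, hx, RCLike.inner_apply, enorm_mul, RCLike.enorm_conj, mul_comm]

/-! ### The quadratic form of the Dirichlet Laplacian -/

/-- The weak equation `-½ Δ u = ε u`, in terms of inner products. The equation is bilinear, so it is
tested with the complex conjugate of `ξ`. -/
theorem sum_inner_grad_eq {u : L2 Ω} {G : Fin d → L2 Ω} {ε : ℝ}
    (h : ∀ ξ, IsTestFunction Ω ξ →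
      (1 / 2 : ℂ) * ∑ i, ∫ x in Ω, G i x * partialDeriv i ξ x
        + ∫ x in Ω, (((fun _ => 0 : EuclideanSpace ℝ (Fin d) → ℝ) x : ℝ) : ℂ) * u x * ξ x
      = ∫ x in Ω, ((ε : ℂ) • u : L2 Ω) x * ξ x) (hξ : IsTestFunction Ω ξ) :
    ∑ i, inner ℂ (hξ.grad i) (G i) = 2 * ε * inner ℂ hξ.toL2 u := by
  have h1 := h _ hξ.conj
  have h2 : ∀ i, ∫ x in Ω, G i x * partialDeriv i (fun x => starRingEnd ℂ (ξ x)) x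
      = inner ℂ (hξ.grad i) (G i) := fun i => by
    rw [L2.inner_def]
    refine integral_congr_ae ?_
    filter_upwards [(hξ.memLp_partialDeriv i).coeFn_toLp] with x hx
    rw [IsTestFunction.grad, hx, RCLike.inner_apply, hξ.partialDeriv_conj]
  have h3 : ∫ x in Ω, ((ε : ℂ) • u : L2 Ω) x * starRingEnd ℂ (ξ x)
      = ε * inner ℂ hξ.toL2 u := by
    rw [← inner_smul_right, L2.inner_def]
    refine integral_congr_ae ?_
    filter_upwards [hξ.memLp.coeFn_toLp] with x hx
    rw [IsTestFunction.toL2, hx, RCLike.inner_apply]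
  simp only [h2, h3, Complex.ofReal_zero, zero_mul, integral_zero, add_zero] at h1
  linear_combination 2 * h1

theorem HasDirichletGradient.sum_inner_eq {u w : L2 Ω} {G W : Fin d → L2 Ω} {ε : ℝ}
    (hw : HasDirichletGradient Ω w W)
    (h : ∀ ξ (hξ : IsTestFunction Ω ξ),
      ∑ i, inner ℂ (hξ.grad i) (G i) = 2 * ε * inner ℂ hξ.toL2 u) :
    ∑ i, inner ℂ (W i) (G i) = 2 * ε * inner ℂ w u := by
  obtain ⟨ξ, hξ, hu, hG⟩ := hw.exists_tendsto
  refine tendsto_nhds_unique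
    (tendsto_finsetSum _ fun i _ => Filter.Tendsto.inner (hG i) tendsto_const_nhds) ?_
  simp_rw [h _ (hξ _)]
  exact (Filter.Tendsto.inner hu tendsto_const_nhds).const_mul _

/-- Bessel's inequality for vectors `G m` which are orthogonal and of squared norm `2 ε m`. -/
theorem sum_two_mul_eps_mul_norm_sq_le {K : Type*} [NormedAddCommGroup K] [InnerProductSpace ℂ K]
    (G : ℕ → K) (ε : ℕ → ℝ) (c : ℕ → ℂ) (W : K)
    (hG : ∀ n m, inner ℂ (G n) (G m) = if n = m then (2 * ε m : ℂ) else 0)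
    (hW : ∀ m, inner ℂ W (G m) = 2 * ε m * starRingEnd ℂ (c m)) (M : ℕ) :
    ∑ m ∈ Finset.range M, 2 * ε m * ‖c m‖ ^ 2 ≤ ‖W‖ ^ 2 := by
  set S := ∑ m ∈ Finset.range M, c m • G m with hS
  have hc : ∀ m, c m * (2 * ε m * starRingEnd ℂ (c m)) = ((2 * ε m * ‖c m‖ ^ 2 : ℝ) : ℂ) := by
    intro m
    have := Complex.mul_conj' (c m)
    push_cast
    linear_combination (2 * ε m : ℂ) * this
  have h1 : inner ℂ W S = ((∑ m ∈ Finset.range M, 2 * ε m * ‖c m‖ ^ 2 : ℝ) : ℂ) := by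
    rw [hS, inner_sum, Complex.ofReal_sum]
    exact Finset.sum_congr rfl fun m _ => by rw [inner_smul_right, hW, hc]
  have h2 : inner ℂ S S = ((∑ m ∈ Finset.range M, 2 * ε m * ‖c m‖ ^ 2 : ℝ) : ℂ) := by
    conv_lhs => rw [hS]
    rw [sum_inner, Complex.ofReal_sum]
    refine Finset.sum_congr rfl fun n hn => ?_
    rw [inner_smul_left, inner_sum, Finset.sum_eq_single n]
    · rw [inner_smul_right, hG, if_pos rfl, ← hc]
      ring
    · intro m _ hm
      rw [inner_smul_right, hG, if_neg hm.symm, mul_zero]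
    · exact fun h => absurd hn h
  have h3 := norm_sub_sq (𝕜 := ℂ) W S
  have h4 := inner_self_eq_norm_sq (𝕜 := ℂ) S
  rw [h1] at h3
  rw [h2] at h4
  have h5 : RCLike.re (((∑ m ∈ Finset.range M, 2 * ε m * ‖c m‖ ^ 2 : ℝ) : ℂ))
    = ∑ m ∈ Finset.range M, 2 * ε m * ‖c m‖ ^ 2 := Complex.ofReal_re _
  rw [h5] at h3 h4
  nlinarith [sq_nonneg ‖W - S‖]

/-- The min-max upper bound for an eigenvalue in averaged form: the eigenvalue `ε k` is at most
the total energy of `k + 1` orthonormal trial states. -/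
theorem two_mul_eps_le_sum {H : Type*} [NormedAddCommGroup H] [InnerProductSpace ℂ H]
    (b : HilbertBasis ℕ ℂ H) {ε : ℕ → ℝ} (hε : Monotone ε) (hε0 : ∀ m, 0 ≤ ε m) {k : ℕ}
    {e : Fin (k + 1) → H} (he : Orthonormal ℂ e) {A : Fin (k + 1) → ℝ}
    (hA : ∀ a M, ∑ m ∈ Finset.range M, 2 * ε m * ‖inner ℂ (b m) (e a)‖ ^ 2 ≤ A a) :
    2 * ε k ≤ ∑ a, A a := by
  set t : ℕ → ℝ := fun m => ∑ a, ‖inner ℂ (b m) (e a)‖ ^ 2 with ht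
  have ht0 : ∀ m, 0 ≤ t m := fun m => Finset.sum_nonneg fun a _ => by positivity
  have ht1 : ∀ m, t m ≤ 1 := fun m => by
    have h := he.sum_inner_products_le (b m) (s := Finset.univ)
    rw [b.orthonormal.1 m, one_pow] at h
    simpa only [ht, norm_inner_symm] using h
  have hsum : HasSum t (k + 1) := by
    have h1 : ∀ a, HasSum (fun m => ‖inner ℂ (b m) (e a)‖ ^ 2) 1 := fun a => by
      have h := (b.hasSum_inner_mul_inner (e a) (e a)).mapL Complex.reCLM
      have h2 : ∀ m, Complex.reCLM (inner ℂ (e a) (b m) * inner ℂ (b m) (e a))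
          = ‖inner ℂ (b m) (e a)‖ ^ 2 := fun m => by
        rw [← inner_conj_symm, Complex.conj_mul', ← Complex.ofReal_pow]
        exact Complex.ofReal_re _
      have h3 : Complex.reCLM (inner ℂ (e a) (e a)) = 1 := by
        have := inner_self_eq_norm_sq (𝕜 := ℂ) (e a)
        rw [he.1 a, one_pow] at this
        exact this
      simpa only [h2, h3] using h
    simpa using hasSum_sum fun a (_ : a ∈ Finset.univ) => h1 a
  have hM : ∀ M, 2 * ε k * ∑ m ∈ Finset.range M, t m ≤ (∑ a, A a) + 2 * ε k * k := by
    intro M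
    have hAM : ∑ m ∈ Finset.range M, 2 * ε m * t m ≤ ∑ a, A a := by
      simp only [ht, Finset.mul_sum]
      rw [Finset.sum_comm]
      exact Finset.sum_le_sum fun a _ => hA a M
    have hk : ∑ m ∈ Finset.range M, (if m < k then 2 * ε k else 0) ≤ 2 * ε k * k := by
      rw [← Finset.sum_filter, Finset.sum_const, nsmul_eq_mul, mul_comm]
      refine mul_le_mul_of_nonneg_left ?_ (by linarith [hε0 k])
      have : ((Finset.range M).filter (· < k)) ⊆ Finset.range k := fun m hm =>
        Finset.mem_range.2 (Finset.mem_filter.1 hm).2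
      simpa using Finset.card_le_card this
    rw [Finset.mul_sum]
    refine le_trans ?_ (add_le_add hAM hk)
    rw [← Finset.sum_add_distrib]
    refine Finset.sum_le_sum fun m _ => ?_
    split_ifs with h
    · nlinarith [hε0 k, mul_nonneg (hε0 m) (ht0 m), mul_nonneg (hε0 k) (sub_nonneg.2 (ht1 m))]
    · nlinarith [mul_nonneg (sub_nonneg.2 (hε (not_lt.1 h))) (ht0 m)]
  have := le_of_tendsto' (hsum.tendsto_sum_nat.const_mul (2 * ε k)) hM
  linarith

end

/-! ### Eigenvalues of the Dirichlet Laplacian in the cube -/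

section

variable {d : ℕ} {Ω : Set (EuclideanSpace ℝ (Fin d))}

theorem EigenSystem.exists_gradient (S : EigenSystem Ω fun _ => 0) :
    ∃ G : ℕ → Fin d → L2 Ω, (∀ m, HasDirichletGradient Ω (S.eigenfunction m) (G m)) ∧
      (∀ n m, ∑ i, inner ℂ (G n i) (G m i) = if n = m then (2 * S.eigenvalue m : ℂ) else 0) ∧
      ∀ m ξ (hξ : IsTestFunction Ω ξ), ∑ i, inner ℂ (hξ.grad i) (G m i)
        = 2 * S.eigenvalue m * inner ℂ hξ.toL2 (S.eigenfunction m) := by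
  choose G hG hS using S.isEigenfunction
  have hξG : ∀ m ξ (hξ : IsTestFunction Ω ξ), ∑ i, inner ℂ (hξ.grad i) (G m i)
      = 2 * S.eigenvalue m * inner ℂ hξ.toL2 (S.eigenfunction m) := fun m ξ hξ =>
    sum_inner_grad_eq (hS m) hξ
  refine ⟨G, hG, fun n m => ?_, hξG⟩
  rw [(hG n).sum_inner_eq (hξG m), orthonormal_iff_ite.1 S.eigenfunction.orthonormal n m]
  split_ifs <;> simp

/-- The eigenfunctions have gradients, and `∫ |∇ u|² = 2 ε` for the eigenvalue `ε`. -/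
theorem EigenSystem.exists_sum_norm_sq_eq (S : EigenSystem Ω fun _ => 0) (k : ℕ) :
    ∃ G : Fin d → L2 Ω, HasDirichletGradient Ω (S.eigenfunction k) G ∧
      ∑ i, ‖G i‖ ^ 2 = 2 * S.eigenvalue k := by
  obtain ⟨G, hG, horth, -⟩ := S.exists_gradient
  refine ⟨G k, hG k, ?_⟩
  have h := horth k k
  rw [if_pos rfl] at h
  simp only [inner_self_eq_norm_sq_to_K, Complex.coe_algebraMap] at h
  exact_mod_cast h

theorem EigenSystem.eigenvalue_nonneg (S : EigenSystem Ω fun _ => 0) (k : ℕ) :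
    0 ≤ S.eigenvalue k := by
  obtain ⟨G, -, h⟩ := S.exists_sum_norm_sq_eq k
  have : 0 ≤ ∑ i, ‖G i‖ ^ 2 := Finset.sum_nonneg fun i _ => by positivity
  linarith

theorem EigenSystem.sum_two_mul_eigenvalue_le (S : EigenSystem Ω fun _ => 0)
    {ξ : EuclideanSpace ℝ (Fin d) → ℂ} (hξ : IsTestFunction Ω ξ) (M : ℕ) :
    ∑ m ∈ Finset.range M, 2 * S.eigenvalue m * ‖inner ℂ (S.eigenfunction m) hξ.toL2‖ ^ 2
      ≤ ∑ i, ‖hξ.grad i‖ ^ 2 := by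
  obtain ⟨G, -, horth, hG⟩ := S.exists_gradient
  have h := sum_two_mul_eps_mul_norm_sq_le
    (fun m => (WithLp.toLp 2 (G m) : PiLp 2 fun _ : Fin d => L2 Ω)) S.eigenvalue
    (fun m => inner ℂ (S.eigenfunction m) hξ.toL2) (WithLp.toLp 2 hξ.grad)
    (fun n m => by rw [PiLp.inner_apply]; exact horth n m)
    (fun m => by rw [PiLp.inner_apply, inner_conj_symm]; exact hG m ξ hξ) M
  rwa [PiLp.norm_sq_eq_of_L2] at h

/-- The eigenvalues are bounded by the Rayleigh quotients of test functions with disjoint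
supports. -/
theorem EigenSystem.two_mul_eigenvalue_le_sum (S : EigenSystem Ω fun _ => 0) {k : ℕ}
    {ξ : Fin (k + 1) → EuclideanSpace ℝ (Fin d) → ℂ} (hξ : ∀ a, IsTestFunction Ω (ξ a))
    (h0 : ∀ a, (hξ a).toL2 ≠ 0) (hdisj : ∀ a b, a ≠ b → ∀ x, ξ a x = 0 ∨ ξ b x = 0) :
    2 * S.eigenvalue k ≤ ∑ a, (∑ i, ‖(hξ a).grad i‖ ^ 2) / ‖(hξ a).toL2‖ ^ 2 := by
  have hn : ∀ a, 0 < ‖(hξ a).toL2‖ := fun a => norm_pos_iff.2 (h0 a)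
  refine two_mul_eps_le_sum S.eigenfunction S.monotone_eigenvalue S.eigenvalue_nonneg
    (e := fun a => ((‖(hξ a).toL2‖⁻¹ : ℝ) : ℂ) • (hξ a).toL2) ⟨fun a => ?_, fun a b hab => ?_⟩
    fun a M => ?_
  · rw [norm_smul, Complex.norm_real, norm_inv, norm_norm, inv_mul_cancel₀ (hn a).ne']
  · change inner ℂ (_ • (hξ a).toL2) (_ • (hξ b).toL2) = 0
    rw [inner_smul_left, inner_smul_right]
    have : inner ℂ (hξ a).toL2 (hξ b).toL2 = 0 := by
      rw [L2.inner_def]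
      refine integral_eq_zero_of_ae ?_
      filter_upwards [(hξ a).memLp.coeFn_toLp, (hξ b).memLp.coeFn_toLp] with x hx hy
      rw [IsTestFunction.toL2, IsTestFunction.toL2, hx, hy]
      rcases hdisj a b hab x with h | h <;> simp [h]
    rw [this, mul_zero, mul_zero]
  · rw [le_div_iff₀ (by have := hn a; positivity), Finset.sum_mul]
    refine le_trans (le_of_eq (Finset.sum_congr rfl fun m _ => ?_))
      (S.sum_two_mul_eigenvalue_le (hξ a) M)
    rw [inner_smul_right, norm_mul, Complex.norm_real, norm_inv, norm_norm]
    have := (hn a).ne'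
    field_simp

end

section

variable {d : ℕ}

theorem exists_disjoint_testFunctions (hd : 1 ≤ d) (k : ℕ) :
    ∃ ξ : Fin (k + 1) → EuclideanSpace ℝ (Fin d) → ℂ,
      (∀ a, IsTestFunction (box d 1) (ξ a)) ∧ (∀ a, ∃ x, ξ a x ≠ 0) ∧
      ∀ a b, a ≠ b → ∀ x, ξ a x = 0 ∨ ξ b x = 0 := by
  set s : ℝ := ((k : ℝ) + 2)⁻¹ with hs
  have hs0 : 0 < s := by positivity
  -- bumps of radius `s / 3` centred on the diagonal of the cube, at distance `s` in each coordinate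
  let c : Fin (k + 1) → EuclideanSpace ℝ (Fin d) := fun a =>
    WithLp.toLp 2 fun _ => ((a : ℕ) + 1 : ℝ) * s - 1 / 2
  let f : ∀ a, ContDiffBump (c a) := fun a => ⟨s / 4, s / 3, by positivity, by linarith⟩
  have hcoord : ∀ a x, x ∈ Metric.closedBall (c a) (s / 3) → ∀ i,
      |x i - (((a : ℕ) + 1 : ℝ) * s - 1 / 2)| ≤ s / 3 := fun a x hx i => by
    rw [mem_closedBall_iff_norm] at hx
    exact (PiLp.norm_apply_le (x - c a) i).trans hx
  refine ⟨fun a x => (f a x : ℂ), fun a => ?_, fun a => ⟨c a, ?_⟩, fun a b hab x => ?_⟩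
  · have hsupp : Function.support (fun x => (f a x : ℂ)) = Function.support (f a) := by
      ext x
      simp
    have ht : tsupport (fun x => (f a x : ℂ)) = Metric.closedBall (c a) (s / 3) := by
      rw [tsupport, hsupp]
      exact (f a).tsupport_eq
    refine ⟨Complex.ofRealCLM.contDiff.comp (f a).contDiff, ?_, ?_⟩
    · rw [HasCompactSupport, ht]
      exact isCompact_closedBall _ _
    · rw [ht]
      intro x hx i
      have h := abs_le.1 (hcoord a x hx i)
      have ha : ((a : ℕ) : ℝ) ≤ k := by exact_mod_cast Nat.lt_succ_iff.1 a.2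
      have hk : ((k : ℝ) + 2) * s = 1 := mul_inv_cancel₀ (by positivity)
      have h1 : ((a : ℕ) : ℝ) * s ≤ k * s := by gcongr
      have h2 : 0 ≤ ((a : ℕ) : ℝ) * s := by positivity
      constructor <;> nlinarith
  · have : f a (c a) = 1 :=
      (f a).one_of_mem_closedBall (Metric.mem_closedBall_self (f a).rIn_pos.le)
    simp [this]
  · by_contra! hcon
    have hmem : ∀ a, (f a x : ℂ) ≠ 0 → x ∈ Metric.closedBall (c a) (s / 3) := fun a ha => by
      have : x ∈ Function.support (f a) := by simpa using ha
      rw [(f a).support_eq] at this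
      exact Metric.ball_subset_closedBall this
    have ha := abs_le.1 (hcoord a x (hmem a hcon.1) ⟨0, hd⟩)
    have hb := abs_le.1 (hcoord b x (hmem b hcon.2) ⟨0, hd⟩)
    rcases lt_or_gt_of_ne (fun h => hab (Fin.ext h) : (a : ℕ) ≠ b) with h | h
    · have : ((a : ℕ) : ℝ) + 1 ≤ (b : ℕ) := by exact_mod_cast h
      nlinarith
    · have : ((b : ℕ) : ℝ) + 1 ≤ (a : ℕ) := by exact_mod_cast h
      nlinarith

theorem IsTestFunction.comp_inv_smul {ξ : EuclideanSpace ℝ (Fin d) → ℂ}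
    (h : IsTestFunction (box d 1) ξ) {l : ℝ} (hl : 0 < l) :
    IsTestFunction (box d l) fun x => ξ (l⁻¹ • x) := by
  refine ⟨h.1.comp (contDiff_const_smul _), h.2.1.comp_smul (inv_ne_zero hl.ne'), ?_⟩
  intro x hx i
  have hx' : l⁻¹ • x ∈ tsupport ξ :=
    tsupport_comp_subset_preimage ξ (continuous_const_smul l⁻¹) hx
  have h1 := h.2.2 hx' i
  rw [PiLp.smul_apply, smul_eq_mul, Set.mem_Ioo, inv_mul_eq_div, lt_div_iff₀ hl,
    div_lt_iff₀ hl] at h1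
  constructor <;> linarith [h1.1, h1.2]

theorem partialDeriv_comp_inv_smul (ξ : EuclideanSpace ℝ (Fin d) → ℂ) (l : ℝ) (i : Fin d)
    (x : EuclideanSpace ℝ (Fin d)) :
    partialDeriv i (fun x => ξ (l⁻¹ • x)) x = l⁻¹ • partialDeriv i ξ (l⁻¹ • x) := by
  rw [partialDeriv, fderiv_comp_smul]
  rfl

theorem exists_eLpNorm_comp_inv_smul (d : ℕ) {l : ℝ} (hl : 0 < l) :
    ∃ κ : ℝ, 0 < κ ∧ ∀ g : EuclideanSpace ℝ (Fin d) → ℂ, Continuous g →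
      (eLpNorm (fun x => g (l⁻¹ • x)) 2 volume).toReal = κ * (eLpNorm g 2 volume).toReal := by
  set K : ℝ := |((l⁻¹) ^ Module.finrank ℝ (EuclideanSpace ℝ (Fin d)))⁻¹| with hK
  have hK0 : 0 < K := by positivity
  refine ⟨(ENNReal.ofReal K ^ (1 / 2 : ℝ)).toReal, ?_, fun g hg => ?_⟩
  · refine ENNReal.toReal_pos ?_ ?_
    · exact (ENNReal.rpow_pos (ENNReal.ofReal_pos.2 hK0) ENNReal.ofReal_ne_top).ne'
    · exact ENNReal.rpow_ne_top_of_nonneg (by norm_num) ENNReal.ofReal_ne_top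
  · have hmap := Measure.map_addHaar_smul (volume : Measure (EuclideanSpace ℝ (Fin d)))
      (inv_ne_zero hl.ne')
    have h := eLpNorm_map_measure (p := 2) (μ := volume) (f := fun x => l⁻¹ • x)
      (g := g) hg.aestronglyMeasurable (measurable_const_smul _).aemeasurable
    rw [hmap, eLpNorm_smul_measure_of_ne_top (by norm_num)] at h
    rw [← ENNReal.toReal_mul]
    change (eLpNorm (g ∘ fun x => l⁻¹ • x) 2 volume).toReal = _
    rw [← h, hK]
    simp

/-- The `k`-th eigenvalue in the cube of side `l` is of order `l⁻²`: compare with rescaled test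
functions. -/
theorem exists_two_mul_eigenvalue_le (hd : 1 ≤ d) (k : ℕ) :
    ∃ C : ℝ, 0 ≤ C ∧ ∀ l : ℝ, 0 < l → ∀ S : EigenSystem (box d l) fun _ => 0,
      2 * S.eigenvalue k ≤ C / l ^ 2 := by
  obtain ⟨ξ, hξ, hne, hdisj⟩ := exists_disjoint_testFunctions hd k
  refine ⟨∑ a, (∑ i, ‖(hξ a).grad i‖ ^ 2) / ‖(hξ a).toL2‖ ^ 2, by positivity, fun l hl S => ?_⟩
  have h0 : ∀ a, (hξ a).toL2 ≠ 0 := fun a h => by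
    obtain ⟨x, hx⟩ := hne a
    have h1 : eLpNorm (ξ a) 2 volume = 0 := by rw [← (hξ a).enorm_toL2, h, enorm_zero]
    rw [eLpNorm_eq_zero_iff (hξ a).1.continuous.aestronglyMeasurable (by norm_num)] at h1
    exact hx (congrFun (((hξ a).1.continuous.ae_eq_iff_eq volume continuous_const).1 h1) x)
  obtain ⟨κ, hκ, hscale⟩ := exists_eLpNorm_comp_inv_smul d hl
  have hξl := fun a => (hξ a).comp_inv_smul hl
  have hnorm : ∀ a, ‖(hξl a).toL2‖ = κ * ‖(hξ a).toL2‖ := fun a => by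
    rw [← toReal_enorm, ← toReal_enorm, (hξl a).enorm_toL2, (hξ a).enorm_toL2,
      hscale _ (hξ a).1.continuous]
  have hgrad : ∀ a i, ‖(hξl a).grad i‖ = κ * l⁻¹ * ‖(hξ a).grad i‖ := fun a i => by
    have hc := continuous_partialDeriv (hξ a).contDiff_one i
    have h1 : partialDeriv i (fun x => ξ a (l⁻¹ • x))
        = l⁻¹ • fun x => partialDeriv i (ξ a) (l⁻¹ • x) :=
      funext fun x => partialDeriv_comp_inv_smul (ξ a) l i x
    rw [← toReal_enorm, ← toReal_enorm, (hξl a).enorm_grad, (hξ a).enorm_grad, h1,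
      eLpNorm_const_smul, ENNReal.toReal_mul, hscale _ hc, toReal_enorm,
      Real.norm_of_nonneg (inv_nonneg.2 hl.le)]
    ring
  have h := S.two_mul_eigenvalue_le_sum hξl
    (fun a => by
      rw [← norm_pos_iff, hnorm]
      exact mul_pos hκ (norm_pos_iff.2 (h0 a)))
    (fun a b hab x => hdisj a b hab _)
  refine h.trans (le_of_eq ?_)
  rw [Finset.sum_div]
  refine Finset.sum_congr rfl fun a _ => ?_
  have := norm_pos_iff.2 (h0 a)
  simp only [hnorm, hgrad, mul_pow, ← Finset.mul_sum]
  field_simp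

/-! ### Localized states are asymptotically orthogonal to kinetic states -/

theorem volume_box_lt_top (d : ℕ) (l : ℝ) : volume (box d l) < ⊤ := by
  have hc : IsCompact ((EuclideanSpace.equiv (Fin d) ℝ).toHomeomorph ⁻¹'
      Set.univ.pi fun _ => Set.Icc (-l / 2) (l / 2)) :=
    (Homeomorph.isCompact_preimage _).2 (isCompact_univ_pi fun _ => isCompact_Icc)
  refine (measure_mono fun x hx => ?_).trans_lt hc.measure_lt_top
  exact fun i _ => Set.Ioo_subset_Icc_self (hx i)

theorem volume_ball_mul_rpow {l δ : ℝ} (hl : 0 < l) (hδ : 0 < δ) :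
    volume (Metric.ball (0 : EuclideanSpace ℝ (Fin d)) (l * δ)) ^ (-(1 / 2) : ℝ)
      = ENNReal.ofReal (l ^ (-(d : ℝ) / 2)) *
        volume (Metric.ball (0 : EuclideanSpace ℝ (Fin d)) δ) ^ (-(1 / 2) : ℝ) := by
  rw [Measure.addHaar_ball_mul_of_pos _ _ hl, finrank_euclideanSpace_fin,
    ENNReal.mul_rpow_of_ne_zero (ENNReal.ofReal_pos.2 (by positivity)).ne'
      (Metric.measure_ball_pos _ _ hδ).ne', ENNReal.ofReal_rpow_of_pos (by positivity),
    ← Real.rpow_natCast, ← Real.rpow_mul hl.le]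
  congr 3
  ring

/-- Kinetic states on the scale `l` vary on the scale `l` only, so they pair weakly with states
whose `L¹` norm is small compared to `l ^ (d / 2)`. -/
theorem tendsto_enorm_inner_eigenfunction (hd : 1 ≤ d) {l : ℕ → ℝ} (hl : ∀ j, 0 < l j)
    (ψ : ∀ j, EigenSystem (box d (l j)) fun _ => 0) (f : ∀ j, L2 (box d (l j)))
    (hf : ∀ j, ‖f j‖ = 1)
    (hloc : Tendsto (fun j => l j ^ (-(d : ℝ) / 2) * ∫ x in box d (l j), ‖f j x‖) atTop (𝓝 0))
    (k : ℕ) :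
    Tendsto (fun j => ‖inner ℂ (f j) ((ψ j).eigenfunction k)‖ₑ) atTop (𝓝 0) := by
  obtain ⟨C, hC, hEk⟩ := exists_two_mul_eigenvalue_le hd k
  set D : ℝ := d * Real.sqrt C with hD
  have hD0 : 0 ≤ D := by positivity
  have key : ∀ δ : ℝ, 0 < δ → ∀ j, ‖inner ℂ (f j) ((ψ j).eigenfunction k)‖ₑ ≤
      volume (Metric.ball (0 : EuclideanSpace ℝ (Fin d)) δ) ^ (-(1 / 2) : ℝ) *
        ENNReal.ofReal (l j ^ (-(d : ℝ) / 2) * ∫ x in box d (l j), ‖f j x‖)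
        + ENNReal.ofReal (δ * D) := by
    intro δ hδ j
    have hlj := hl j
    obtain ⟨G, hG, hGk⟩ := (ψ j).exists_sum_norm_sq_eq k
    have : IsFiniteMeasure (volume.restrict (box d (l j))) :=
      ⟨by simpa using volume_box_lt_top d (l j)⟩
    have hint : Integrable (f j) (volume.restrict (box d (l j))) :=
      (Lp.memLp (f j)).integrable one_le_two
    have h1 := hG.enorm_inner_le (f j) hint.2.ne (mul_pos hlj hδ)
    have hGsum : ∑ i, ‖G i‖ₑ ≤ ENNReal.ofReal (D / l j) := by
      simp only [← ofReal_norm]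
      rw [← ENNReal.ofReal_sum_of_nonneg fun i _ => norm_nonneg _]
      refine ENNReal.ofReal_le_ofReal ?_
      have hGi : ∀ i, ‖G i‖ ≤ Real.sqrt C / l j := fun i => by
        have h2 : ‖G i‖ ^ 2 ≤ C / l j ^ 2 :=
          (Finset.single_le_sum (f := fun i => ‖G i‖ ^ 2) (fun _ _ => by positivity)
            (Finset.mem_univ i)).trans (hGk.trans_le (hEk _ hlj (ψ j)))
        refine (pow_le_pow_iff_left₀ (norm_nonneg _) (by positivity) two_ne_zero).1 ?_
        rwa [div_pow, Real.sq_sqrt hC]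
      refine (Finset.sum_le_sum fun i _ => hGi i).trans (le_of_eq ?_)
      rw [Finset.sum_const, Finset.card_univ, Fintype.card_fin, nsmul_eq_mul, hD, mul_div_assoc]
    have hψ : ‖(ψ j).eigenfunction k‖ₑ = 1 := by
      rw [← ofReal_norm, (ψ j).eigenfunction.orthonormal.1 k, ENNReal.ofReal_one]
    have hfj : ‖f j‖ₑ = 1 := by rw [← ofReal_norm, hf j, ENNReal.ofReal_one]
    rw [hψ, hfj, mul_one, one_mul, volume_ball_mul_rpow hlj hδ,
      ← ofReal_integral_norm_eq_lintegral_enorm hint] at h1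
    refine h1.trans (add_le_add (le_of_eq ?_) ?_)
    · rw [ENNReal.ofReal_mul (by positivity)]
      ring
    · calc ENNReal.ofReal (l j * δ) * ∑ i, ‖G i‖ₑ
          ≤ ENNReal.ofReal (l j * δ) * ENNReal.ofReal (D / l j) := by gcongr
        _ = ENNReal.ofReal (δ * D) := by
            rw [← ENNReal.ofReal_mul (by positivity)]
            congr 1
            field_simp
  have hlim : ∀ δ : ℝ, 0 < δ → Tendsto (fun j =>
      volume (Metric.ball (0 : EuclideanSpace ℝ (Fin d)) δ) ^ (-(1 / 2) : ℝ) *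
        ENNReal.ofReal (l j ^ (-(d : ℝ) / 2) * ∫ x in box d (l j), ‖f j x‖)) atTop (𝓝 0) := by
    intro δ hδ
    have h1 := ENNReal.tendsto_ofReal hloc
    rw [ENNReal.ofReal_zero] at h1
    have h2 := ENNReal.Tendsto.const_mul (a := volume
      (Metric.ball (0 : EuclideanSpace ℝ (Fin d)) δ) ^ (-(1 / 2) : ℝ)) h1 (Or.inr
        (ENNReal.rpow_ne_top_of_ne_zero (Metric.measure_ball_pos _ _ hδ).ne'
          measure_ball_lt_top.ne))
    rwa [mul_zero] at h2
  rw [ENNReal.tendsto_nhds_zero]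
  intro η hη
  -- choose the radius of the averaging ball so that the error term is at most `η / 2`
  have hδ : ∃ δ : ℝ, 0 < δ ∧ ENNReal.ofReal (δ * D) ≤ η / 2 := by
    have h1 : Tendsto (fun δ : ℝ => ENNReal.ofReal (δ * D)) (𝓝[>] 0) (𝓝 0) := by
      have : Tendsto (fun δ : ℝ => ENNReal.ofReal (δ * D)) (𝓝 0) (𝓝 (ENNReal.ofReal (0 * D))) :=
        ENNReal.tendsto_ofReal (tendsto_id.mul_const D)
      rw [zero_mul, ENNReal.ofReal_zero] at this
      exact this.mono_left nhdsWithin_le_nhds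
    obtain ⟨δ, h2, h3⟩ := ((ENNReal.tendsto_nhds_zero.1 h1 (η / 2) (ENNReal.half_pos hη.ne')).and
      self_mem_nhdsWithin).exists
    exact ⟨δ, h3, h2⟩
  obtain ⟨δ, hδ0, hδη⟩ := hδ
  filter_upwards [ENNReal.tendsto_nhds_zero.1 (hlim δ hδ0) (η / 2) (ENNReal.half_pos hη.ne')]
    with j hj
  calc _ ≤ _ := key δ hδ0 j
    _ ≤ η / 2 + η / 2 := add_le_add hj hδη
    _ = η := ENNReal.add_halves η

end

end BoseGas

end

theorem mainTheorem1 (d : ℕ) (hd : 1 ≤ d)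
    (β lam ρ : ℝ) (hβ : 0 < β) (hlam : 0 ≤ lam) (hρ : 0 < ρ)
    (l : ℕ → ℝ) (hl : ∀ j, 1 ≤ l j) (hl_top : Tendsto l atTop atTop)
    (v : ℕ → EuclideanSpace ℝ (Fin d) → ℝ)
    (hv_meas : ∀ j, AEMeasurable (v j) (volume.restrict (BoseGas.box d (l j))))
    (hv_nonneg : ∀ j, ∀ x ∈ BoseGas.box d (l j), 0 ≤ v j x)
    (hv_bdd : ∀ j, ∃ M : ℝ, ∀ x ∈ BoseGas.box d (l j), v j x ≤ M)
    (φ : ∀ j, BoseGas.EigenSystem (BoseGas.box d (l j)) (v j))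
    (ψ : ∀ j, BoseGas.EigenSystem (BoseGas.box d (l j)) (fun _ => 0))
    (μ : ℕ → ℝ)
    (hμ : ∀ j, BoseGas.totalDensity (φ j) β (μ j) lam = ENNReal.ofReal ρ)
    (hloc : ∀ i, Tendsto
      (fun j => (l j) ^ (-(d : ℝ) / 2) *
        ∫ x in BoseGas.box d (l j), ‖((φ j).eigenfunction i : BoseGas.L2 _) x‖)
      atTop (𝓝 0)) :
    (∀ k, Tendsto
      (fun j => BoseGas.stateDensity (φ j) β (μ j) lam ((ψ j).eigenfunction k))
      atTop (𝓝 0)) ∧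
    (BoseGas.GeneralizedBEC (fun j => (ψ j).eigenvalue)
        (fun j k => BoseGas.stateDensity (φ j) β (μ j) lam ((ψ j).eigenfunction k)) →
      BoseGas.TypeThreeBEC (fun j => (ψ j).eigenvalue)
        (fun j k => BoseGas.stateDensity (φ j) β (μ j) lam ((ψ j).eigenfunction k))) := by
  have main : ∀ k, Tendsto
      (fun j => BoseGas.stateDensity (φ j) β (μ j) lam ((ψ j).eigenfunction k))
      atTop (𝓝 0) := by
    intro k
    have hinner : ∀ i, Tendsto
        (fun j => ‖inner ℂ ((φ j).eigenfunction i) ((ψ j).eigenfunction k)‖ₑ) atTop (𝓝 0) :=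
      fun i => BoseGas.tendsto_enorm_inner_eigenfunction hd (fun j => zero_lt_one.trans_le (hl j))
        ψ _ (fun j => (φ j).eigenfunction.orthonormal.1 i) (hloc i) k
    rw [ENNReal.tendsto_nhds_zero]
    intro η hη
    -- eigenstates of `h_l` beyond the first `K` hold a density of at most `η / 2` each
    have hK : ∃ K : ℕ, ENNReal.ofReal ρ / (K + 1) ≤ η / 2 := by
      have h1 : Tendsto (fun K : ℕ => ENNReal.ofReal ρ / ((K + 1 : ℕ) : ℝ≥0∞)) atTop (𝓝 0) := by
        have := ENNReal.Tendsto.const_div (a := ENNReal.ofReal ρ)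
          (ENNReal.tendsto_nat_nhds_top.comp (tendsto_add_atTop_nat 1))
          (Or.inr ENNReal.ofReal_ne_top)
        rwa [ENNReal.div_top] at this
      obtain ⟨K, h⟩ := (ENNReal.tendsto_nhds_zero.1 h1 (η / 2) (ENNReal.half_pos hη.ne')).exists
      exact ⟨K, by exact_mod_cast h⟩
    obtain ⟨K, hK⟩ := hK
    have hsum : Tendsto (fun j => (∑ i ∈ Finset.range K,
        ‖inner ℂ ((φ j).eigenfunction i) ((ψ j).eigenfunction k)‖ₑ ^ 2) * ENNReal.ofReal ρ)
        atTop (𝓝 0) := by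
      have h1 := tendsto_finsetSum (Finset.range K) fun i _ =>
        ENNReal.Tendsto.pow (n := 2) (hinner i)
      have h2 := ENNReal.Tendsto.mul_const h1 (Or.inr ENNReal.ofReal_ne_top : _ ∨ _ ≠ ⊤)
        (b := ENNReal.ofReal ρ)
      simpa using h2
    filter_upwards [ENNReal.tendsto_nhds_zero.1 hsum (η / 2) (ENNReal.half_pos hη.ne')] with j hj
    have hψ : ‖(ψ j).eigenfunction k‖ₑ = 1 := by
      rw [← ofReal_norm, (ψ j).eigenfunction.orthonormal.1 k, ENNReal.ofReal_one]
    have h := BoseGas.stateDensity_le (φ j) hβ.le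
      (by rw [hμ j]; exact (ENNReal.ofReal_pos.2 hρ).ne') ((ψ j).eigenfunction k) K
    rw [hμ j, hψ, one_pow, one_mul] at h
    calc _ ≤ _ := h
      _ ≤ η / 2 + η / 2 := add_le_add hj hK
      _ = η := ENNReal.add_halves η
  refine ⟨main, fun h => ⟨h, fun k ⟨c, hc, hlim⟩ => ?_⟩⟩
  exact hc.ne' (tendsto_nhds_unique hlim (main k))
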